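/- Let $M$ be a compact smooth surface without boundary (Hausdorff, not assumed orientable or connected) with a smooth Riemannian metric $(g_{ij})$, volume $dV$, Levi-Civita connection $\nabla$, and Gaussian curvature $K$ that vanishes at no point of $M$. Then the following hold. (1) If $\psi\in C^2(M)$ is a real function that satisfies the Monge–Ampère equation $$\det[D^2\psi]=\frac{\det(g_{ij})\,K}{2}\,|\nabla\psi|^2$$ at every point, where $(D^2\psi)_{ij}=\partial_i\partial_j\psi-\sum_k\Gamma^k_{ij}\partial_k\psi$ is the covariant Hessian in local coordinates, then $\psi$ is locally constant; so $\psi$ is constant if $M$ is connected. (2) If $X$ is a $C^2$ vector field on $M$ with $\operatorname{div}X=0$ and $\operatorname{div}\nabla_XX=0$ at every point, then $X=0$. (3) More generally, if $X$ is a $C^1$ vector field on $M$ with $\operatorname{div}X=0$ and with $\operatorname{div}\nabla_XX=0$ in the sense of distributions, i.e. $\int_M d\varphi(\nabla_XX)\,dV=0$ for all $\varphi\in C^\infty(M)$, then $X=0$. (4) The group $\mathcal{SD}(M)$ of volume-preserving smooth diffeomorphisms, as a subgroup of the group $\mathcal D(M)$ of all smooth diffeomorphisms with the $L^2$ metric $\langle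 V,W\rangle_\eta=\int_M g_{\eta(x)}(V(x),W(x))\,dV(x)$, has no asymptotic directions: for every $\eta\in\mathcal{SD}(M)$, the only asymptotic vector at $\eta$ of class $C^1$ is $0$. Here a vector $V=X\circ\eta$ with $X$ a $C^1$ divergence-free field is asymptotic if the second fundamental form of $\mathcal{SD}(M)$ in $\mathcal D(M)$ vanishes on it, i.e. if the $L^2$-normal component of $(\nabla_XX)\circ\eta$ is zero: $(\nabla_XX)\circ\eta$ is $L^2$-orthogonal to every smooth field along $\eta$ that is $L^2$-orthogonal to all $Y\circ\eta$ with $Y$ a smooth divergence-free field. -/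

import Mathlib

open MeasureTheory Manifold
open scoped ContDiff

noncomputable section

namespace SurfaceFlow

/-- The coordinate plane. -/
abbrev E2 : Type := EuclideanSpace ℝ (Fin 2)

/-- The partial derivative of `f` in the `k`-th coordinate direction. -/
def pd (k : Fin 2) (f : E2 → ℝ) (y : E2) : ℝ :=
  fderiv ℝ f y (EuclideanSpace.single k 1)

variable {M : Type*} [TopologicalSpace M] [ChartedSpace E2 M]

section Frames

/-- The coordinate vector field `∂ᵢ` of the chart around `p`, at a point `q` of its domain. -/
def frame (p q : M) (i : Fin 2) : TangentSpace (𝓡 2) q :=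
  (mfderiv (𝓡 2) 𝓘(ℝ, E2) (extChartAt (𝓡 2) p) q).inverse (EuclideanSpace.single i (1 : ℝ))

/-- The `i`-th component of the vector field `X` in the chart around `p`, as a function of the
coordinates `y`. -/
def comp (X : ∀ x : M, TangentSpace (𝓡 2) x) (p : M) (i : Fin 2) (y : E2) : ℝ :=
  (show E2 from mfderiv (𝓡 2) 𝓘(ℝ, E2) (extChartAt (𝓡 2) p) ((extChartAt (𝓡 2) p).symm y)
    (X ((extChartAt (𝓡 2) p).symm y))) i

/-- The vector field `X` is of class `C^n`. -/
def IsField (n : ℕ∞ω) (X : ∀ x : M, TangentSpace (𝓡 2) x) [IsManifold (𝓡 2) ∞ M] : Prop :=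
  ContMDiff (𝓡 2) (𝓡 2).tangent n (fun x => (⟨x, X x⟩ : TangentBundle (𝓡 2) M))

end Frames

variable [IsManifold (𝓡 2) ∞ M]

/-- Smooth Riemannian metrics on the surface `M`. -/
abbrev Metric (M : Type*) [TopologicalSpace M] [ChartedSpace E2 M] [IsManifold (𝓡 2) ∞ M] :
    Type _ :=
  Bundle.ContMDiffRiemannianMetric (𝓡 2) ∞ E2 (fun x : M => TangentSpace (𝓡 2) x)

variable (g : Metric M)

/-- The matrix `(g_{ij})` in the chart around `p`, at the coordinates `y`. -/
def gram (p : M) (y : E2) : Matrix (Fin 2) (Fin 2) ℝ := fun i j =>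
  g.inner ((extChartAt (𝓡 2) p).symm y) (frame p ((extChartAt (𝓡 2) p).symm y) i)
    (frame p ((extChartAt (𝓡 2) p).symm y) j)

/-- The Christoffel symbol `Γᵏᵢⱼ` of the Levi-Civita connection. -/
def christoffel (p : M) (k i j : Fin 2) (y : E2) : ℝ :=
  (1 / 2) * ∑ l, (gram g p y)⁻¹ k l *
    (pd i (fun z => gram g p z j l) y + pd j (fun z => gram g p z i l) y
      - pd l (fun z => gram g p z i j) y)

/-- The component `Rˡ_{kij}` of the curvature tensor: `R(∂ᵢ, ∂ⱼ)∂ₖ = ∑ₗ Rˡ_{kij} ∂ₗ`, where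
`R(X, Y) = ∇_X ∇_Y - ∇_Y ∇_X - ∇_[X,Y]`. -/
def riemann (p : M) (l k i j : Fin 2) (y : E2) : ℝ :=
  pd i (christoffel g p l j k) y - pd j (christoffel g p l i k) y
    + ∑ m, (christoffel g p l i m y * christoffel g p m j k y
      - christoffel g p l j m y * christoffel g p m i k y)

/-- The Gaussian curvature at `x`: `g(R(∂₀, ∂₁)∂₁, ∂₀) / det (g_{ij})`, evaluated in the chart
around `x`. -/
def gaussCurvature (x : M) : ℝ :=
  (∑ l, gram g x (extChartAt (𝓡 2) x x) l 0 * riemann g x l 1 0 1 (extChartAt (𝓡 2) x x))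
    / (gram g x (extChartAt (𝓡 2) x x)).det

/-! The Monge-Ampere equation. -/

/-- The covariant Hessian `D²ψ`, `(D²ψ)_{ij} = ∂ᵢ∂ⱼψ - ∑ₖ Γᵏᵢⱼ ∂ₖψ`, in the chart around `p`. -/
def hessian (ψ : M → ℝ) (p : M) (y : E2) : Matrix (Fin 2) (Fin 2) ℝ := fun i j =>
  pd i (pd j (fun z => ψ ((extChartAt (𝓡 2) p).symm z))) y
    - ∑ k, christoffel g p k i j y * pd k (fun z => ψ ((extChartAt (𝓡 2) p).symm z)) y

/-- `|∇ψ|² = ∑ gⁱʲ ∂ᵢψ ∂ⱼψ`, in the chart around `p`. -/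
def gradNormSq (ψ : M → ℝ) (p : M) (y : E2) : ℝ :=
  ∑ i, ∑ j, (gram g p y)⁻¹ i j * pd i (fun z => ψ ((extChartAt (𝓡 2) p).symm z)) y
    * pd j (fun z => ψ ((extChartAt (𝓡 2) p).symm z)) y

/-- `ψ` solves `det D²ψ = (det(g_{ij}) K / 2) |∇ψ|²`. Both sides are multiplied by the same factor
under a change of coordinates; at each point `x` the chart around `x` is used. -/
def SolvesMongeAmpere (ψ : M → ℝ) : Prop :=
  ∀ x : M, (hessian g ψ x (extChartAt (𝓡 2) x x)).det =
    (gram g x (extChartAt (𝓡 2) x x)).det * gaussCurvature g x / 2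
      * gradNormSq g ψ x (extChartAt (𝓡 2) x x)

/-! Covariant derivative, divergence, volume. -/

/-- The matrix `(∇ⱼX)ⁱ = ∂ⱼXⁱ + ∑ₖ Γⁱⱼₖ Xᵏ` (row `i`, column `j`) of `v ↦ ∇_v X`, in the chart
around `p`. -/
def covMatrix (X : ∀ x : M, TangentSpace (𝓡 2) x) (p : M) (y : E2) :
    Matrix (Fin 2) (Fin 2) ℝ := fun i j =>
  pd j (comp X p i) y + ∑ k, christoffel g p i j k y * comp X p k y

/-- The vector field `∇_X Y`. -/
def covDeriv (X Y : ∀ x : M, TangentSpace (𝓡 2) x) : ∀ x : M, TangentSpace (𝓡 2) x := fun x =>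
  ∑ i, (∑ j, covMatrix g Y x (extChartAt (𝓡 2) x x) i j * comp X x j (extChartAt (𝓡 2) x x))
    • frame x x i

/-- The divergence of a (differentiable) vector field, the trace of `v ↦ ∇_v X`. -/
def divergence (X : ∀ x : M, TangentSpace (𝓡 2) x) (x : M) : ℝ :=
  (covMatrix g X x (extChartAt (𝓡 2) x x)).trace

variable [MeasurableSpace M]

/-- The measure `√det(g_{ij}) dy` of the chart around `p`, transported to the domain of the chart
and extended by zero to `M`. -/
def chartVolume (p : M) : Measure M :=
  (((volume : Measure E2).restrict (extChartAt (𝓡 2) p).target).withDensity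
    (fun y => ENNReal.ofReal (Real.sqrt (gram g p y).det))).map (extChartAt (𝓡 2) p).symm

/-- The Riemannian volume `dV`. The measures `chartVolume g p` are the restrictions of `dV` to the
domains of the charts, which cover `M`, so that `dV` is their least upper bound. -/
def vol : Measure M := ⨆ p : M, chartVolume g p

/-- `div W = 0` in the sense of distributions: `∫ dφ(W) dV = 0` for all smooth functions `φ`.
(`M` will be compact.) -/
def IsWeaklyDivFree (W : ∀ x : M, TangentSpace (𝓡 2) x) : Prop :=
  ∀ φ : M → ℝ, ContMDiff (𝓡 2) 𝓘(ℝ, ℝ) ∞ φ →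
    ∫ x, (show ℝ from mfderiv (𝓡 2) 𝓘(ℝ, ℝ) φ x (W x)) ∂(vol g) = 0

/-! The group `SD(M)` of volume-preserving diffeomorphisms in the group `D(M)` of all
diffeomorphisms. A tangent vector of `D(M)` at `η` is a field `x ↦ V x ∈ T_{η(x)} M` along `η`. -/

/-- The `L²` inner product on the tangent space of `D(M)` at `η`. -/
def innerL2 (η : M → M) (V W : ∀ x : M, TangentSpace (𝓡 2) (η x)) : ℝ :=
  ∫ x, g.inner (η x) (V x) (W x) ∂(vol g)

/-- `η` belongs to `SD(M)`: it preserves the Riemannian volume. -/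
def IsVolumePreserving (η : M ≃ₘ^∞⟮𝓡 2, 𝓡 2⟯ M) : Prop :=
  MeasurePreserving η (vol g) (vol g)

/-- `Z` is a smooth field along `η` normal to `SD(M)`: `L²`-orthogonal at `η` to the tangent space
of `SD(M)`, which consists of the fields `Y ∘ η` with `Y` a smooth divergence-free field. -/
def IsNormal (η : M ≃ₘ^∞⟮𝓡 2, 𝓡 2⟯ M) (Z : ∀ x : M, TangentSpace (𝓡 2) (η x)) : Prop :=
  ContMDiff (𝓡 2) (𝓡 2).tangent ∞ (fun x => (⟨η x, Z x⟩ : TangentBundle (𝓡 2) M)) ∧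
    ∀ Y : ∀ x : M, TangentSpace (𝓡 2) x, IsField ∞ Y → (∀ x, divergence g Y x = 0) →
      innerL2 g η Z (fun x => Y (η x)) = 0

/-- `V` is an asymptotic vector of `SD(M)` at `η`, of class `C¹`: it is tangent to `SD(M)`, that is
`V = X ∘ η` with `X` divergence-free, and the second fundamental form of `SD(M)` in `D(M)` vanishes
on it, that is `(∇_X X) ∘ η`, the covariant derivative of `V` along `V` in `D(M)`, has zero normal
component. -/
def IsAsymptotic (η : M ≃ₘ^∞⟮𝓡 2, 𝓡 2⟯ M) (V : ∀ x : M, TangentSpace (𝓡 2) (η x)) : Prop :=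
  ∃ X : ∀ x : M, TangentSpace (𝓡 2) x, IsField 1 X ∧ (∀ x, divergence g X x = 0) ∧
    (∀ x, V x = X (η x)) ∧
    ∀ Z : ∀ x : M, TangentSpace (𝓡 2) (η x), IsNormal g η Z →
      innerL2 g η (fun x => covDeriv g X X (η x)) Z = 0

end SurfaceFlow

end

/-!
Each part rests on a maximum principle for a tensor `T` that is degenerate only where the object
under study vanishes.

Let `X` be divergence-free. Commuting covariant derivatives gives
`div ∇_X X = tr (∇X)² + Ric(X, X)`, and `Ric = K g` on a surface (`IsMetricOn.ricci_eq`). So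
`div ∇_X X = 0` means `tr (∇X)² + K |X|² = 0`. As `tr ∇X = 0`, this reads `2 det ∇X = K |X|²`, and
since `K` has no zeros, `∇X` is invertible wherever `X ≠ 0`. At a maximum of `|X|²`, however,
`g(∇_v X, X) = 0` for all `v`, so `∇X` is invertible only if `X = 0` there
(`eq_zero_of_det_eq_zero`). Hence the maximum of `|X|²` is zero. The same argument applies to a
solution `ψ` of the Monge-Ampère equation: at a maximum of `|∇ψ|²` the gradient lies in the kernel
of `D²ψ`, so the equation makes the maximum zero (`gradNormSq_eq_zero_of_isMaxOn`), and `dψ = 0`.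

For a field of class `C¹` the identity is obtained by testing against functions supported in a chart
(`IsMetricOn.trace_sq_add_curvature`). The only second derivatives of `X` that remain after an
integration by parts are mixed ones, and these commute in the weak sense
(`IsTest.integral_pd_mul_pd_comm`, by difference quotients). The first-order expression that is left
is continuous, so its vanishing in the weak sense is pointwise vanishing. For a field of class `C²`
the hypothesis `div ∇_X X = 0` is first put in the weak form by the divergence theorem in a chart.

All objects are defined by coordinates in the preferred chart at each point. That the chart does not
matter follows from the transformation law of the Christoffel symbols
(`IsIsometryOn.chr_transform`), which is deduced from the uniqueness of the Levi-Civita connection.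
The Riemannian volume is a supremum of chart volumes. By the change of variables formula it
restricts to the volume of each chart (`vol_restrict_source`), which turns the integrals over the
surface into integrals over the plane.

For asymptotic vectors, the gradient along `η` of a function supported in a chart is normal to the
group of volume-preserving diffeomorphisms (`isNormal_gradExtend`). Pairing `(∇_X X) ∘ η` with it
and using that `η` preserves the volume gives the weak equation `div ∇_X X = 0`.
-/

noncomputable section

namespace SurfaceFlow

open Filter Topology

/-! ### Calculus and Riemannian metrics on plane domains -/

section Calculus

variable {f h : E2 → ℝ} {y : E2} {U : Set E2}

theorem pd_congr (k : Fin 2) (H : f =ᶠ[𝓝 y] h) : pd k f y = pd k h y := by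
  simp only [pd, H.fderiv_eq]

theorem pd_add (k : Fin 2) (hf : DifferentiableAt ℝ f y) (hh : DifferentiableAt ℝ h y) :
    pd k (fun z => f z + h z) y = pd k f y + pd k h y := by
  simp only [pd, fderiv_fun_add hf hh]; rfl

theorem pd_mul (k : Fin 2) (hf : DifferentiableAt ℝ f y) (hh : DifferentiableAt ℝ h y) :
    pd k (fun z => f z * h z) y = pd k f y * h y + f y * pd k h y := by
  simp only [pd, fderiv_fun_mul hf hh]
  simp [mul_comm, add_comm]

theorem pd_sub (k : Fin 2) (hf : DifferentiableAt ℝ f y) (hh : DifferentiableAt ℝ h y) :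
    pd k (fun z => f z - h z) y = pd k f y - pd k h y := by
  simp only [pd, fderiv_fun_sub hf hh]; rfl

theorem pd_neg (k : Fin 2) : pd k (fun z => - f z) y = - pd k f y := by
  simp only [pd, fderiv_fun_neg]; rfl

/-- A vector of the plane is the combination of the coordinate vectors. -/
theorem eq_single_add_single (v : E2) :
    v = v 0 • EuclideanSpace.single 0 (1 : ℝ) + v 1 • EuclideanSpace.single 1 (1 : ℝ) := by
  ext i; fin_cases i <;> simp

theorem fderiv_apply_eq_pd (v : E2) : fderiv ℝ f y v = v 0 * pd 0 f y + v 1 * pd 1 f y := by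
  conv_lhs => rw [eq_single_add_single v]
  simp [pd]

theorem pd_comp_apply {τ : E2 → E2} (hτ : DifferentiableAt ℝ τ y) (k c : Fin 2) :
    pd k (fun z => τ z c) y = fderiv ℝ τ y (EuclideanSpace.single k 1) c := by
  have := ((EuclideanSpace.proj c : E2 →L[ℝ] ℝ).hasFDerivAt.comp y hτ.hasFDerivAt).fderiv
  exact congrArg (fun L : E2 →L[ℝ] ℝ => L (EuclideanSpace.single k 1)) this

/-- The chain rule in coordinates. -/
theorem pd_comp {τ : E2 → E2} (k : Fin 2) (hf : DifferentiableAt ℝ f (τ y))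
    (hτ : DifferentiableAt ℝ τ y) :
    pd k (fun z => f (τ z)) y
      = pd 0 f (τ y) * pd k (fun z => τ z 0) y + pd 1 f (τ y) * pd k (fun z => τ z 1) y := by
  have := (hf.hasFDerivAt.comp y hτ.hasFDerivAt).fderiv
  have h2 : pd k (fun z => f (τ z)) y
      = fderiv ℝ f (τ y) (fderiv ℝ τ y (EuclideanSpace.single k 1)) :=
    congrArg (fun L : E2 →L[ℝ] ℝ => L (EuclideanSpace.single k 1)) this
  rw [h2, fderiv_apply_eq_pd, pd_comp_apply hτ, pd_comp_apply hτ]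
  ring

theorem pd_eq_zero_of_notMem_tsupport (k : Fin 2) (hy : y ∉ tsupport f) : pd k f y = 0 :=
  image_eq_zero_of_notMem_tsupport (f := pd k f) fun h => hy (tsupport_fderiv_apply_subset ℝ _ h)

theorem contDiffOn_pd {n m : ℕ∞ω} (k : Fin 2) (hU : IsOpen U) (hf : ContDiffOn ℝ n f U)
    (hmn : m + 1 ≤ n) : ContDiffOn ℝ m (pd k f) U :=
  (hf.fderiv_of_isOpen hU hmn).clm_apply contDiffOn_const

theorem differentiableAt_of_contDiffOn {n : ℕ∞ω} {E F : Type*} [NormedAddCommGroup E]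
    [NormedSpace ℝ E] [NormedAddCommGroup F] [NormedSpace ℝ F] {U : Set E} {y : E} {f : E → F}
    (hU : IsOpen U) (hf : ContDiffOn ℝ n f U)
    (hn : n ≠ 0) (hy : y ∈ U) : DifferentiableAt ℝ f y :=
  (hf.contDiffAt (hU.mem_nhds hy)).differentiableAt hn

theorem pd_comm (i j : Fin 2) (hf : ContDiffAt ℝ 2 f y) :
    pd i (pd j f) y = pd j (pd i f) y := by
  have hs : IsSymmSndFDerivAt ℝ f y := hf.isSymmSndFDerivAt (by simp)
  have hd : DifferentiableAt ℝ (fderiv ℝ f) y :=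
    (hf.fderiv_right (m := 1) (by norm_num)).differentiableAt (by norm_num)
  have key : ∀ a b : Fin 2, pd a (pd b f) y
      = fderiv ℝ (fderiv ℝ f) y (EuclideanSpace.single a 1) (EuclideanSpace.single b 1) := by
    intro a b
    have : fderiv ℝ (fun z => fderiv ℝ f z (EuclideanSpace.single b 1)) y
        = (fderiv ℝ (fderiv ℝ f) y).flip (EuclideanSpace.single b 1) := by
      rw [fderiv_clm_apply hd (differentiableAt_const _)]
      simp
    change fderiv ℝ (fun z => fderiv ℝ f z (EuclideanSpace.single b 1)) y _ = _
    rw [this]; rfl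
  rw [key, key, hs.eq]

end Calculus

/-- The Christoffel symbols `Γᵏᵢⱼ` of a matrix-valued function on the plane; `christoffel g p` is
`chr (gram g p)` by definition. -/
def chr (G : E2 → Matrix (Fin 2) (Fin 2) ℝ) (k i j : Fin 2) (y : E2) : ℝ :=
  (1 / 2) * ∑ l, (G y)⁻¹ k l *
    (pd i (fun z => G z j l) y + pd j (fun z => G z i l) y - pd l (fun z => G z i j) y)

/-- The curvature tensor of a matrix-valued function on the plane, with the index convention of
`riemann`. -/
def riem (G : E2 → Matrix (Fin 2) (Fin 2) ℝ) (l k i j : Fin 2) (y : E2) : ℝ :=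
  pd i (chr G l j k) y - pd j (chr G l i k) y
    + ∑ m, (chr G l i m y * chr G m j k y - chr G l j m y * chr G m i k y)

/-- `G` is a smooth field of symmetric matrices with positive determinant on the open subset `U` of
the plane. This holds for the matrix of a Riemannian metric; negative definite forms are not
excluded, as only the determinant matters to the local computations. -/
structure IsMetricOn (G : E2 → Matrix (Fin 2) (Fin 2) ℝ) (U : Set E2) : Prop where
  isOpen : IsOpen U
  symm : ∀ y ∈ U, ∀ i j, G y i j = G y j i
  det_pos : ∀ y ∈ U, 0 < (G y).det
  contDiffOn : ∀ i j, ContDiffOn ℝ ∞ (fun y => G y i j) U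

namespace IsMetricOn

variable {G : E2 → Matrix (Fin 2) (Fin 2) ℝ} {U : Set E2} {y : E2}

theorem pd_symm (hG : IsMetricOn G U) (hy : y ∈ U) (k i j : Fin 2) :
    pd k (fun z => G z i j) y = pd k (fun z => G z j i) y :=
  pd_congr k (by filter_upwards [hG.isOpen.mem_nhds hy] with z hz using hG.symm z hz i j)

theorem chr_symm (hG : IsMetricOn G U) (hy : y ∈ U) (k i j : Fin 2) :
    chr G k i j y = chr G k j i y := by
  simp only [chr]
  congr 1
  refine Finset.sum_congr rfl fun l _ => ?_
  rw [hG.pd_symm hy l i j]; ring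

theorem sum_mul_inv (hG : IsMetricOn G U) (hy : y ∈ U) (i j : Fin 2) :
    G y i 0 * (G y)⁻¹ 0 j + G y i 1 * (G y)⁻¹ 1 j = if i = j then 1 else 0 := by
  have h := Matrix.mul_nonsing_inv (G y) (isUnit_iff_ne_zero.2 (hG.det_pos y hy).ne')
  have := congrFun (congrFun h i) j
  simpa [Matrix.mul_apply, Fin.sum_univ_two, Matrix.one_apply] using this

/-- The Christoffel symbols of the first kind. -/
theorem sum_mul_chr (hG : IsMetricOn G U) (hy : y ∈ U) (l i j : Fin 2) :
    G y l 0 * chr G 0 i j y + G y l 1 * chr G 1 i j y = 1 / 2 * (pd i (fun z => G z j l) y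
      + pd j (fun z => G z i l) y - pd l (fun z => G z i j) y) := by
  have h0 := hG.sum_mul_inv hy l 0
  have h1 := hG.sum_mul_inv hy l 1
  simp only [chr, Fin.sum_univ_two]
  fin_cases l <;> simp only [Fin.zero_eta, Fin.mk_one, Fin.isValue, if_true, zero_ne_one,
    one_ne_zero, if_false] at h0 h1 ⊢ <;>
  linear_combination (1 / 2) * (pd i (fun z => G z j 0) y
      + pd j (fun z => G z i 0) y - pd 0 (fun z => G z i j) y) * h0 + (1 / 2) *
      (pd i (fun z => G z j 1) y + pd j (fun z => G z i 1) y - pd 1 (fun z => G z i j) y) * h1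

/-- The Levi-Civita connection is compatible with the metric. -/
theorem pd_eq (hG : IsMetricOn G U) (hy : y ∈ U) (k i j : Fin 2) :
    pd k (fun z => G z i j) y = (G y j 0 * chr G 0 k i y + G y j 1 * chr G 1 k i y)
      + (G y i 0 * chr G 0 k j y + G y i 1 * chr G 1 k j y) := by
  rw [hG.sum_mul_chr hy, hG.sum_mul_chr hy, hG.pd_symm hy k j i]
  ring

/-- Multiplication by the matrix of the metric is injective. -/
theorem eq_of_sum_mul_eq (hG : IsMetricOn G U) (hy : y ∈ U) {a b : Fin 2 → ℝ}
    (h : ∀ l, G y l 0 * a 0 + G y l 1 * a 1 = G y l 0 * b 0 + G y l 1 * b 1) : a = b := by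
  have hd : G y 0 0 * G y 1 1 - G y 0 1 * G y 1 0 ≠ 0 := by
    have := (hG.det_pos y hy).ne'; rwa [Matrix.det_fin_two] at this
  have h0 := h 0
  have h1 := h 1
  funext i
  fin_cases i <;> refine mul_left_cancel₀ hd ?_ <;> simp only [Fin.zero_eta, Fin.mk_one]
  · linear_combination G y 1 1 * h0 - G y 0 1 * h1
  · linear_combination G y 0 0 * h1 - G y 1 0 * h0

/-- The Levi-Civita connection is the only torsion-free connection compatible with the metric. -/
theorem chr_unique (hG : IsMetricOn G U) (hy : y ∈ U) {C : Fin 2 → Fin 2 → Fin 2 → ℝ}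
    (hs : ∀ k i j, C k i j = C k j i)
    (hc : ∀ k i j, pd k (fun z => G z i j) y = (G y j 0 * C 0 k i + G y j 1 * C 1 k i)
      + (G y i 0 * C 0 k j + G y i 1 * C 1 k j)) (k i j : Fin 2) :
    C k i j = chr G k i j y := by
  refine congrFun (hG.eq_of_sum_mul_eq (a := fun k => C k i j) (b := fun k => chr G k i j y) hy
    fun l => ?_) k
  rw [hG.sum_mul_chr hy, hc i, hc j, hc l, hs 0 j i, hs 1 j i, hs 0 l i, hs 1 l i, hs 0 l j,
    hs 1 l j]
  ring

theorem contDiffOn_det (hG : IsMetricOn G U) : ContDiffOn ℝ ∞ (fun y => (G y).det) U := by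
  simp only [Matrix.det_fin_two]
  exact ((hG.contDiffOn 0 0).mul (hG.contDiffOn 1 1)).sub
    ((hG.contDiffOn 0 1).mul (hG.contDiffOn 1 0))

theorem contDiffOn_inv (hG : IsMetricOn G U) (i j : Fin 2) :
    ContDiffOn ℝ ∞ (fun y => (G y)⁻¹ i j) U := by
  have hd := hG.contDiffOn_det.inv fun y hy => (hG.det_pos y hy).ne'
  have : (fun y => (G y)⁻¹ i j) = fun y => ((G y).det)⁻¹ * (G y).adjugate i j := by
    funext y; simp [Matrix.inv_def]
  rw [this]
  refine hd.mul ?_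
  simp only [Matrix.adjugate_fin_two]
  fin_cases i <;> fin_cases j <;> simp
  exacts [hG.contDiffOn 1 1, (hG.contDiffOn 0 1).neg, (hG.contDiffOn 1 0).neg, hG.contDiffOn 0 0]

theorem contDiffOn_chr (hG : IsMetricOn G U) (k i j : Fin 2) : ContDiffOn ℝ ∞ (chr G k i j) U := by
  have hp : ∀ a b c, ContDiffOn ℝ ∞ (pd a (fun z => G z b c)) U := fun a b c =>
    contDiffOn_pd a hG.isOpen (hG.contDiffOn b c) (by simp)
  unfold chr
  exact contDiffOn_const.mul (ContDiffOn.sum fun l _ =>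
    (hG.contDiffOn_inv k l).mul (((hp _ _ _).add (hp _ _ _)).sub (hp _ _ _)))

theorem differentiableAt_chr (hG : IsMetricOn G U) (hy : y ∈ U) (k i j : Fin 2) :
    DifferentiableAt ℝ (chr G k i j) y :=
  differentiableAt_of_contDiffOn hG.isOpen (hG.contDiffOn_chr k i j) (by simp) hy

theorem differentiableAt (hG : IsMetricOn G U) (hy : y ∈ U) (i j : Fin 2) :
    DifferentiableAt ℝ (fun z => G z i j) y :=
  differentiableAt_of_contDiffOn hG.isOpen (hG.contDiffOn i j) (by simp) hy

theorem contDiffOn_sqrt_det (hG : IsMetricOn G U) :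
    ContDiffOn ℝ ∞ (fun y => Real.sqrt (G y).det) U :=
  hG.contDiffOn_det.sqrt fun y hy => (hG.det_pos y hy).ne'

/-- The logarithmic derivative of the area density is the trace of the Christoffel symbols. -/
theorem pd_sqrt_det (hG : IsMetricOn G U) (hy : y ∈ U) (k : Fin 2) :
    pd k (fun z => Real.sqrt (G z).det) y
      = Real.sqrt (G y).det * (chr G 0 k 0 y + chr G 1 k 1 y) := by
  have hσ : DifferentiableAt ℝ (fun z => Real.sqrt (G z).det) y :=
    differentiableAt_of_contDiffOn hG.isOpen hG.contDiffOn_sqrt_det (by simp) hy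
  have hpos := Real.sqrt_pos.2 (hG.det_pos y hy)
  have h1 : pd k (fun z => Real.sqrt (G z).det * Real.sqrt (G z).det) y
      = pd k (fun z => G z 0 0 * G z 1 1 - G z 0 1 * G z 1 0) y := by
    refine pd_congr k ?_
    filter_upwards [hG.isOpen.mem_nhds hy] with z hz
    rw [Real.mul_self_sqrt (hG.det_pos z hz).le, Matrix.det_fin_two]
  have hd := hG.differentiableAt hy
  rw [pd_mul k hσ hσ, pd_sub k ((hd _ _).fun_mul (hd _ _)) ((hd _ _).fun_mul (hd _ _)),
    pd_mul k (hd _ _) (hd _ _), pd_mul k (hd _ _) (hd _ _), hG.pd_eq hy, hG.pd_eq hy, hG.pd_eq hy,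
    hG.pd_eq hy] at h1
  have h2 := Real.mul_self_sqrt (hG.det_pos y hy).le
  rw [Matrix.det_fin_two] at h2
  have h3 := hG.symm y hy 1 0
  simp only [Matrix.det_fin_two] at hpos h1 ⊢
  rw [h3] at h1 h2 hpos ⊢
  refine mul_left_cancel₀ hpos.ne' ?_
  linear_combination (1 / 2) * h1 - (chr G 0 k 0 y + chr G 1 k 1 y) * h2

/-- Contraction of the curvature tensor with the metric gives a form which is skew in the first
two indices, because second derivatives of the metric commute. -/
theorem riem_skew (hG : IsMetricOn G U) (hy : y ∈ U) (i j : Fin 2) :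
    (G y j 0 * riem G 0 i 0 1 y + G y j 1 * riem G 1 i 0 1 y)
      + (G y i 0 * riem G 0 j 0 1 y + G y i 1 * riem G 1 j 0 1 y) = 0 := by
  have hd := hG.differentiableAt hy
  have hc := hG.differentiableAt_chr hy
  have key : ∀ l k : Fin 2, pd l (pd k (fun z => G z i j)) y =
      (pd l (fun z => G z j 0) y * chr G 0 k i y + G y j 0 * pd l (chr G 0 k i) y)
      + (pd l (fun z => G z j 1) y * chr G 1 k i y + G y j 1 * pd l (chr G 1 k i) y)
      + ((pd l (fun z => G z i 0) y * chr G 0 k j y + G y i 0 * pd l (chr G 0 k j) y)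
      + (pd l (fun z => G z i 1) y * chr G 1 k j y + G y i 1 * pd l (chr G 1 k j) y)) := by
    intro l k
    rw [← pd_mul l (hd _ _) (hc _ _ _), ← pd_mul l (hd _ _) (hc _ _ _),
      ← pd_mul l (hd _ _) (hc _ _ _), ← pd_mul l (hd _ _) (hc _ _ _),
      ← pd_add l ((hd _ _).fun_mul (hc _ _ _)) ((hd _ _).fun_mul (hc _ _ _)),
      ← pd_add l ((hd _ _).fun_mul (hc _ _ _)) ((hd _ _).fun_mul (hc _ _ _)),
      ← pd_add l (((hd _ _).fun_mul (hc _ _ _)).fun_add ((hd _ _).fun_mul (hc _ _ _)))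
        (((hd _ _).fun_mul (hc _ _ _)).fun_add ((hd _ _).fun_mul (hc _ _ _)))]
    refine pd_congr l ?_
    filter_upwards [hG.isOpen.mem_nhds hy] with z hz using hG.pd_eq hz k i j
  have hcomm := pd_comm 0 1 (((hG.contDiffOn i j).contDiffAt (hG.isOpen.mem_nhds hy)).of_le
    (WithTop.coe_le_coe.2 le_top))
  rw [key, key] at hcomm
  simp only [hG.pd_eq hy] at hcomm
  have h3 : G y 1 0 = G y 0 1 := hG.symm y hy 1 0
  simp only [riem, Fin.sum_univ_two]
  fin_cases i <;> fin_cases j <;> simp only [Fin.zero_eta, Fin.mk_one, Fin.isValue] at hcomm ⊢ <;>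
  first
  | linear_combination hcomm
  | (simp only [h3] at hcomm ⊢; linear_combination hcomm)

/-- On a surface the Ricci curvature is the Gaussian curvature times the metric: by `riem_skew` the
curvature tensor has only one independent component. -/
theorem ricci_eq (hG : IsMetricOn G U) (hy : y ∈ U) (j k : Fin 2) :
    riem G 0 k 0 j y + riem G 1 k 1 j y
      = (G y 0 0 * riem G 0 1 0 1 y + G y 1 0 * riem G 1 1 0 1 y) / (G y).det * G y j k := by
  have hdet := (hG.det_pos y hy).ne'
  have q00 := hG.riem_skew hy 0 0
  have q01 := hG.riem_skew hy 0 1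
  have q11 := hG.riem_skew hy 1 1
  have h3 := hG.symm y hy 1 0
  have ha : ∀ l k i j, riem G l k i j y = - riem G l k j i y := by
    intro l k i j; simp only [riem, Fin.sum_univ_two]; ring
  have hz : ∀ l k i, riem G l k i i y = 0 := by
    intro l k i; simp only [riem, Fin.sum_univ_two]; ring
  rw [Matrix.det_fin_two] at hdet ⊢
  rw [div_mul_eq_mul_div, eq_div_iff hdet]
  fin_cases j <;> fin_cases k <;> simp only [Fin.zero_eta, Fin.mk_one, Fin.isValue, hz]
  · rw [ha 1 0 1 0]; simp only [h3] at *
    linear_combination - G y 0 0 * q01 + (1 / 2) * G y 0 1 * q00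
  · rw [ha 1 1 1 0]; simp only [h3] at *; linear_combination - (1 / 2) * G y 0 0 * q11
  · simp only [h3] at *; linear_combination - G y 0 1 * q01 + (1 / 2) * G y 1 1 * q00
  · simp only [h3] at *; linear_combination - (1 / 2) * G y 0 1 * q11

end IsMetricOn

/-! ### Transformation of the connection under isometries -/

/-- The matrix `∂ⱼXⁱ + ∑ₖ Γⁱⱼₖ Xᵏ` of the covariant derivative of the field with components `X`, for
the Levi-Civita connection of `G`. -/
def covM (G : E2 → Matrix (Fin 2) (Fin 2) ℝ) (X : Fin 2 → E2 → ℝ) (i j : Fin 2) (y : E2) : ℝ :=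
  pd j (X i) y + ∑ k, chr G i j k y * X k y

/-- `τ` is a smooth map from the plane domain `V` to the plane domain `U` that pulls the metric `G`
on `U` back to the metric `G'` on `V`. It need not be injective. -/
structure IsIsometryOn (τ : E2 → E2) (G G' : E2 → Matrix (Fin 2) (Fin 2) ℝ) (U V : Set E2) :
    Prop where
  source : IsMetricOn G' V
  target : IsMetricOn G U
  contDiffOn : ContDiffOn ℝ ∞ τ V
  mapsTo : ∀ y ∈ V, τ y ∈ U
  pullback : ∀ y ∈ V, ∀ a b, G' y a b =
    ∑ c, ∑ d, pd a (fun z => τ z c) y * pd b (fun z => τ z d) y * G (τ y) c d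

namespace IsIsometryOn

variable {τ : E2 → E2} {G G' : E2 → Matrix (Fin 2) (Fin 2) ℝ} {U V : Set E2} {y : E2}

theorem det_eq (h : IsIsometryOn τ G G' U V) (hy : y ∈ V) :
    (G' y).det = (pd 0 (fun z => τ z 0) y * pd 1 (fun z => τ z 1) y
      - pd 1 (fun z => τ z 0) y * pd 0 (fun z => τ z 1) y) ^ 2 * (G (τ y)).det := by
  simp only [Matrix.det_fin_two, h.pullback y hy, Fin.sum_univ_two]
  ring

theorem jacobian_ne_zero (h : IsIsometryOn τ G G' U V) (hy : y ∈ V) :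
    pd 0 (fun z => τ z 0) y * pd 1 (fun z => τ z 1) y
      - pd 1 (fun z => τ z 0) y * pd 0 (fun z => τ z 1) y ≠ 0 := by
  intro h0
  have := h.det_eq hy
  rw [h0] at this
  have := h.source.det_pos y hy
  simp_all

theorem contDiffOn_comp (h : IsIsometryOn τ G G' U V) (c : Fin 2) :
    ContDiffOn ℝ ∞ (fun z => τ z c) V :=
  (EuclideanSpace.proj c : E2 →L[ℝ] ℝ).contDiff.comp_contDiffOn h.contDiffOn

theorem differentiableAt (h : IsIsometryOn τ G G' U V) (hy : y ∈ V) : DifferentiableAt ℝ τ y :=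
  differentiableAt_of_contDiffOn h.source.isOpen h.contDiffOn (by simp) hy

theorem differentiableAt_pd (h : IsIsometryOn τ G G' U V) (hy : y ∈ V) (a c : Fin 2) :
    DifferentiableAt ℝ (pd a fun z => τ z c) y :=
  differentiableAt_of_contDiffOn h.source.isOpen
    (contDiffOn_pd (m := ∞) a h.source.isOpen (h.contDiffOn_comp c) (by simp)) (by simp) hy

theorem pd_pd_comm (h : IsIsometryOn τ G G' U V) (hy : y ∈ V) (a i j : Fin 2) :
    pd i (pd j fun z => τ z a) y = pd j (pd i fun z => τ z a) y :=
  pd_comm i j (((h.contDiffOn_comp a).contDiffAt (h.source.isOpen.mem_nhds hy)).of_le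
    (WithTop.coe_le_coe.2 le_top))

/-- The derivative of the pulled back metric. -/
theorem pd_pullback (h : IsIsometryOn τ G G' U V) (hy : y ∈ V) (j a b : Fin 2) :
    pd j (fun z => G' z a b) y = ∑ c, ∑ d,
      ((pd j (pd a fun z => τ z c) y * pd b (fun z => τ z d) y
        + pd a (fun z => τ z c) y * pd j (pd b fun z => τ z d) y) * G (τ y) c d
      + pd a (fun z => τ z c) y * pd b (fun z => τ z d) y *
        (pd 0 (fun z => G z c d) (τ y) * pd j (fun z => τ z 0) y
          + pd 1 (fun z => G z c d) (τ y) * pd j (fun z => τ z 1) y)) := by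
  have hJ := h.differentiableAt_pd hy
  have hg : ∀ c d, DifferentiableAt ℝ (fun z => G z c d) (τ y) :=
    h.target.differentiableAt (h.mapsTo y hy)
  have hgc : ∀ c d, DifferentiableAt ℝ (fun z => G (τ z) c d) y := fun c d =>
    (hg c d).comp y (h.differentiableAt hy)
  have hterm : ∀ c d, DifferentiableAt ℝ (fun z => pd a (fun z => τ z c) z *
      pd b (fun z => τ z d) z * G (τ z) c d) y := fun c d =>
    ((hJ a c).fun_mul (hJ b d)).fun_mul (hgc c d)
  have hpd : ∀ c d, pd j (fun z => pd a (fun z => τ z c) z *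
      pd b (fun z => τ z d) z * G (τ z) c d) y =
      (pd j (pd a fun z => τ z c) y * pd b (fun z => τ z d) y
        + pd a (fun z => τ z c) y * pd j (pd b fun z => τ z d) y) * G (τ y) c d
      + pd a (fun z => τ z c) y * pd b (fun z => τ z d) y *
        (pd 0 (fun z => G z c d) (τ y) * pd j (fun z => τ z 0) y
          + pd 1 (fun z => G z c d) (τ y) * pd j (fun z => τ z 1) y) := by
    intro c d
    rw [pd_mul j ((hJ a c).fun_mul (hJ b d)) (hgc c d), pd_mul j (hJ a c) (hJ b d),
      ← pd_comp j (hg c d) (h.differentiableAt hy)]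
  simp only [← hpd, Fin.sum_univ_two]
  rw [← pd_add j (hterm _ _) (hterm _ _), ← pd_add j (hterm _ _) (hterm _ _),
    ← pd_add j ((hterm _ _).fun_add (hterm _ _)) ((hterm _ _).fun_add (hterm _ _))]
  refine pd_congr j ?_
  filter_upwards [h.source.isOpen.mem_nhds hy] with z hz
  simp only [h.pullback z hz, Fin.sum_univ_two]

/-- The transformation law of the Christoffel symbols. It is derived from the uniqueness of the
Levi-Civita connection: the symbols obtained by the law are symmetric and compatible with `G'`. -/
theorem chr_transform (h : IsIsometryOn τ G G' U V) (hy : y ∈ V) (a j k : Fin 2) :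
    ∑ i, pd i (fun z => τ z a) y * chr G' i j k y = pd j (pd k fun z => τ z a) y
      + ∑ b, ∑ c, chr G a b c (τ y) * pd j (fun z => τ z b) y * pd k (fun z => τ z c) y := by
  set J : Fin 2 → Fin 2 → ℝ := fun c i => pd i (fun z => τ z c) y with hJ
  set D : ℝ := J 0 0 * J 1 1 - J 0 1 * J 1 0 with hD
  have hD0 : D ≠ 0 := h.jacobian_ne_zero hy
  set R : Fin 2 → Fin 2 → Fin 2 → ℝ := fun a j k => pd j (pd k fun z => τ z a) y
      + ∑ b, ∑ c, chr G a b c (τ y) * J b j * J c k with hR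
  have hRs : ∀ a j k, R a j k = R a k j := by
    intro a j k
    simp only [hR, h.pd_pd_comm hy a j k, Fin.sum_univ_two,
      h.target.chr_symm (h.mapsTo y hy) a 1 0]
    ring
  -- the solution of `J C = R` by Cramer's rule
  set C : Fin 2 → Fin 2 → Fin 2 → ℝ := fun i j k =>
    (if i = 0 then J 1 1 * R 0 j k - J 0 1 * R 1 j k else J 0 0 * R 1 j k - J 1 0 * R 0 j k) / D
    with hC
  have hJC : ∀ a j k, J a 0 * C 0 j k + J a 1 * C 1 j k = R a j k := by
    intro a j k
    simp only [hC, if_true, one_ne_zero, if_false]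
    rw [mul_div_assoc', mul_div_assoc', ← add_div, div_eq_iff hD0]
    fin_cases a <;> simp only [Fin.zero_eta, Fin.mk_one, hD] <;> ring
  have key : ∀ i j k, C i j k = chr G' i j k y := by
    refine h.source.chr_unique hy ?_ ?_
    · intro i j k; simp only [hC, hRs _ j k]
    · intro j a b
      have hm := h.mapsTo y hy
      have hs := h.target.symm _ hm 1 0
      have e : ∀ p q r, (G' y p 0 * C 0 q r + G' y p 1 * C 1 q r)
          = ∑ c, ∑ d, J c p * G (τ y) c d * R d q r := by
        intro p q r
        simp only [h.pullback y hy, ← hJC, Fin.sum_univ_two, hJ]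
        ring
      rw [e, e, h.pd_pullback hy]
      simp only [h.target.pd_eq hm, Fin.sum_univ_two, hR, hJ, hs]
      ring
  have := hJC a j k
  simp only [key] at this
  rw [Fin.sum_univ_two]
  exact this

variable {X X' : Fin 2 → E2 → ℝ}

/-- The covariant derivative is a tensor. -/
theorem covM_transform (h : IsIsometryOn τ G G' U V) (hy : y ∈ V)
    (hX : ∀ a, DifferentiableAt ℝ (X a) (τ y)) (hX' : ∀ i, DifferentiableAt ℝ (X' i) y)
    (hXX' : ∀ z ∈ V, ∀ a, X a (τ z) = ∑ i, pd i (fun z => τ z a) z * X' i z) (a j : Fin 2) :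
    ∑ b, covM G X a b (τ y) * pd j (fun z => τ z b) y
      = ∑ i, pd i (fun z => τ z a) y * covM G' X' i j y := by
  have hJ := h.differentiableAt_pd hy
  have e1 := pd_comp j (hX a) (h.differentiableAt hy)
  have e2 : pd j (fun z => X a (τ z)) y = pd j (fun z => pd 0 (fun z => τ z a) z * X' 0 z
      + pd 1 (fun z => τ z a) z * X' 1 z) y := by
    refine pd_congr j ?_
    filter_upwards [h.source.isOpen.mem_nhds hy] with z hz
    simp only [hXX' z hz, Fin.sum_univ_two]
  rw [e1, pd_add j ((hJ _ _).fun_mul (hX' _)) ((hJ _ _).fun_mul (hX' _)),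
    pd_mul j (hJ _ _) (hX' _), pd_mul j (hJ _ _) (hX' _)] at e2
  have c0 := h.chr_transform hy a j 0
  have c1 := h.chr_transform hy a j 1
  simp only [covM, Fin.sum_univ_two, hXX' y hy] at *
  linear_combination e2 - X' 0 y * c0 - X' 1 y * c1

/-- The divergence is a scalar. -/
theorem trace_covM (h : IsIsometryOn τ G G' U V) (hy : y ∈ V)
    (hX : ∀ a, DifferentiableAt ℝ (X a) (τ y)) (hX' : ∀ i, DifferentiableAt ℝ (X' i) y)
    (hXX' : ∀ z ∈ V, ∀ a, X a (τ z) = ∑ i, pd i (fun z => τ z a) z * X' i z) :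
    covM G X 0 0 (τ y) + covM G X 1 1 (τ y) = covM G' X' 0 0 y + covM G' X' 1 1 y := by
  have e := h.covM_transform hy hX hX' hXX'
  have e00 := e 0 0
  have e01 := e 0 1
  have e10 := e 1 0
  have e11 := e 1 1
  simp only [Fin.sum_univ_two] at e00 e01 e10 e11
  refine mul_left_cancel₀ (h.jacobian_ne_zero hy) ?_
  linear_combination pd 1 (fun z => τ z 1) y * e00 - pd 1 (fun z => τ z 0) y * e10
    - pd 0 (fun z => τ z 1) y * e01 + pd 0 (fun z => τ z 0) y * e11

end IsIsometryOn

/-! ### The metric and vector fields in charts -/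

section

variable {M : Type*} [TopologicalSpace M] [ChartedSpace E2 M]

/-- The change of coordinates from the chart around `q` to the chart around `p`. -/
def transition (p q : M) (y : E2) : E2 := extChartAt (𝓡 2) p ((extChartAt (𝓡 2) q).symm y)

/-- The domain of the change of coordinates from the chart around `q` to the chart around `p`. -/
def overlap (p q : M) : Set E2 :=
  (extChartAt (𝓡 2) q).target ∩ (extChartAt (𝓡 2) q).symm ⁻¹' (extChartAt (𝓡 2) p).source

theorem isOpen_overlap (p q : M) : IsOpen (overlap p q) :=
  (continuousOn_extChartAt_symm q).isOpen_inter_preimage (isOpen_extChartAt_target q)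
    (isOpen_extChartAt_source p)

theorem transition_mem {p q : M} {y : E2} (hy : y ∈ overlap p q) :
    transition p q y ∈ (extChartAt (𝓡 2) p).target :=
  (extChartAt (𝓡 2) p).map_source hy.2

theorem symm_transition {p q : M} {y : E2} (hy : y ∈ overlap p q) :
    (extChartAt (𝓡 2) p).symm (transition p q y) = (extChartAt (𝓡 2) q).symm y :=
  (extChartAt (𝓡 2) p).left_inv hy.2

theorem mem_overlap {p q m : M} (hp : m ∈ (extChartAt (𝓡 2) p).source)
    (hq : m ∈ (extChartAt (𝓡 2) q).source) : extChartAt (𝓡 2) q m ∈ overlap p q :=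
  ⟨(extChartAt (𝓡 2) q).map_source hq, by
    rw [Set.mem_preimage, (extChartAt (𝓡 2) q).left_inv hq]; exact hp⟩

theorem transition_extChartAt {p q m : M} (hq : m ∈ (extChartAt (𝓡 2) q).source) :
    transition p q (extChartAt (𝓡 2) q m) = extChartAt (𝓡 2) p m := by
  rw [transition, (extChartAt (𝓡 2) q).left_inv hq]

/-- The differential of the chart around `p`, with values in the coordinate plane. -/
def chartD (p m : M) : TangentSpace (𝓡 2) m →L[ℝ] E2 :=
  mfderiv (𝓡 2) 𝓘(ℝ, E2) (extChartAt (𝓡 2) p) m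

theorem frame_eq (p m : M) (i : Fin 2) :
    frame p m i = (chartD p m).inverse (EuclideanSpace.single i (1 : ℝ)) := rfl

theorem comp_apply (X : ∀ x : M, TangentSpace (𝓡 2) x) (p : M) (i : Fin 2) (y : E2) :
    comp X p i y
      = chartD p ((extChartAt (𝓡 2) p).symm y) (X ((extChartAt (𝓡 2) p).symm y)) i := rfl

theorem comp_extChartAt (X : ∀ x : M, TangentSpace (𝓡 2) x)
    {p m : M} (hp : m ∈ (extChartAt (𝓡 2) p).source) (i : Fin 2) :
    comp X p i (extChartAt (𝓡 2) p m) = chartD p m (X m) i := by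
  rw [comp_apply, (extChartAt (𝓡 2) p).left_inv hp]

variable [IsManifold (𝓡 2) ∞ M]

theorem contDiffOn_transition (p q : M) : ContDiffOn ℝ ∞ (transition p q) (overlap p q) := by
  have h1 : ContMDiffOn 𝓘(ℝ, E2) (𝓡 2) ∞ (extChartAt (𝓡 2) q).symm (overlap p q) :=
    (contMDiffOn_extChartAt_symm q).mono Set.inter_subset_left
  have h2 : ContMDiffOn (𝓡 2) 𝓘(ℝ, E2) ∞ (extChartAt (𝓡 2) p) (extChartAt (𝓡 2) p).source := by
    have := contMDiffOn_extChartAt (I := 𝓡 2) (n := ∞) (x := p)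
    rwa [← extChartAt_source (𝓡 2)] at this
  exact (h2.comp h1 fun y hy => hy.2).contDiffOn

variable {p q m : M}

theorem mdifferentiableAt_chart (hp : m ∈ (extChartAt (𝓡 2) p).source) :
    MDifferentiableAt (𝓡 2) 𝓘(ℝ, E2) (extChartAt (𝓡 2) p) m :=
  have : IsManifold (𝓡 2) 1 M := IsManifold.of_le (n := ∞) (by simp)
  mdifferentiableAt_extChartAt (by rwa [← extChartAt_source (𝓡 2)])

theorem chartD_comp (hp : m ∈ (extChartAt (𝓡 2) p).source)
    (hq : m ∈ (extChartAt (𝓡 2) q).source) :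
    chartD p m = (fderiv ℝ (transition p q) (extChartAt (𝓡 2) q m)).comp (chartD q m) := by
  have hτ : DifferentiableAt ℝ (transition p q) (extChartAt (𝓡 2) q m) :=
    differentiableAt_of_contDiffOn (isOpen_overlap p q) (contDiffOn_transition p q) (by simp)
      (mem_overlap hp hq)
  have h := mfderiv_comp m hτ.mdifferentiableAt (mdifferentiableAt_chart hq)
  rw [mfderiv_eq_fderiv] at h
  have h2 : mfderiv (𝓡 2) 𝓘(ℝ, E2) (extChartAt (𝓡 2) p) m
      = mfderiv (𝓡 2) 𝓘(ℝ, E2) (transition p q ∘ extChartAt (𝓡 2) q) m := by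
    refine Filter.EventuallyEq.mfderiv_eq ?_
    filter_upwards [(isOpen_extChartAt_source q).mem_nhds hq] with z hz
    exact (transition_extChartAt hz).symm
  exact h2.trans h

theorem isInvertible_chartD (hp : m ∈ (extChartAt (𝓡 2) p).source) : (chartD p m).IsInvertible :=
  have : IsManifold (𝓡 2) 1 M := IsManifold.of_le (n := ∞) (by simp)
  isInvertible_mfderiv_extChartAt hp

theorem chartD_frame (hp : m ∈ (extChartAt (𝓡 2) p).source) (i : Fin 2) :
    chartD p m (frame p m i) = EuclideanSpace.single i (1 : ℝ) := by
  rw [frame_eq, (isInvertible_chartD hp).self_apply_inverse]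

theorem chartD_injective (hp : m ∈ (extChartAt (𝓡 2) p).source) :
    Function.Injective (chartD p m) := by
  obtain ⟨e, he⟩ := isInvertible_chartD hp
  rw [← he]; exact e.injective

theorem eq_sum_frame (hp : m ∈ (extChartAt (𝓡 2) p).source) (v : TangentSpace (𝓡 2) m) :
    v = chartD p m v 0 • frame p m 0 + chartD p m v 1 • frame p m 1 := by
  apply chartD_injective hp
  rw [map_add, map_smul, map_smul, chartD_frame hp, chartD_frame hp]
  exact eq_single_add_single _

theorem differentiableAt_transition {y : E2} (hy : y ∈ overlap p q) :
    DifferentiableAt ℝ (transition p q) y :=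
  differentiableAt_of_contDiffOn (isOpen_overlap p q) (contDiffOn_transition p q) (by simp) hy

theorem frame_transform (hp : m ∈ (extChartAt (𝓡 2) p).source)
    (hq : m ∈ (extChartAt (𝓡 2) q).source) (i : Fin 2) :
    frame q m i = pd i (fun z => transition p q z 0) (extChartAt (𝓡 2) q m) • frame p m 0
      + pd i (fun z => transition p q z 1) (extChartAt (𝓡 2) q m) • frame p m 1 := by
  have hd := differentiableAt_transition (mem_overlap hp hq)
  rw [pd_comp_apply hd, pd_comp_apply hd, ← chartD_frame hq, ← ContinuousLinearMap.comp_apply,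
    ← chartD_comp hp hq]
  exact eq_sum_frame hp _

theorem chartD_transform (hp : m ∈ (extChartAt (𝓡 2) p).source)
    (hq : m ∈ (extChartAt (𝓡 2) q).source) (v : TangentSpace (𝓡 2) m) (a : Fin 2) :
    chartD p m v a = ∑ i, pd i (fun z => transition p q z a) (extChartAt (𝓡 2) q m)
      * chartD q m v i := by
  have hd := differentiableAt_transition (mem_overlap hp hq)
  rw [chartD_comp hp hq, ContinuousLinearMap.comp_apply, Fin.sum_univ_two, pd_comp_apply hd,
    pd_comp_apply hd]
  conv_lhs => rw [eq_single_add_single (chartD q m v)]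
  simp [mul_comm]

/-- The transformation law of the components of a vector field. -/
theorem comp_transform (X : ∀ x : M, TangentSpace (𝓡 2) x) {y : E2} (hy : y ∈ overlap p q)
    (a : Fin 2) : comp X p a (transition p q y)
      = ∑ i, pd i (fun z => transition p q z a) y * comp X q i y := by
  have hm := (extChartAt (𝓡 2) q).map_target hy.1
  have h := chartD_transform hy.2 hm (X ((extChartAt (𝓡 2) q).symm y)) a
  rw [(extChartAt (𝓡 2) q).right_inv hy.1] at h
  rw [comp_apply, symm_transition hy, h]
  rfl

/-- A field is smooth on the domain of a chart if and only if its components are. -/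
theorem contMDiffOn_field_iff {n : ℕ∞ω} (hn : n ≤ ∞) (p : M) {X : ∀ x : M, TangentSpace (𝓡 2) x} :
    ContMDiffOn (𝓡 2) (𝓡 2).tangent n
      (fun m => (⟨m, X m⟩ : TangentBundle (𝓡 2) M)) (extChartAt (𝓡 2) p).source ↔
    ContMDiffOn (𝓡 2) 𝓘(ℝ, E2) n (fun m => chartD p m (X m)) (extChartAt (𝓡 2) p).source := by
  have : IsManifold (𝓡 2) 1 M := IsManifold.of_le (n := ∞) (by simp)
  have : IsManifold (𝓡 2) (n + 1) M := IsManifold.of_le (n := ∞) (by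
    calc n + 1 ≤ ∞ + 1 := by gcongr
      _ = ∞ := rfl)
  have : ContMDiffVectorBundle n E2 (TangentSpace (𝓡 2) : M → Type _) (𝓡 2) :=
    TangentBundle.contMDiffVectorBundle
  have h := (trivializationAt E2 (TangentSpace (𝓡 2)) p).contMDiffOn_section_baseSet_iff
    (IB := 𝓡 2) (n := n) (s := X)
  rw [TangentBundle.trivializationAt_baseSet, ← extChartAt_source (𝓡 2)] at h
  refine h.trans (contMDiffOn_congr fun m hm => ?_)
  rw [extChartAt_source] at hm
  have h2 := TangentBundle.continuousLinearMapAt_trivializationAt (I := 𝓡 2) hm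
  have h3 : (trivializationAt E2 (TangentSpace (𝓡 2)) p).continuousLinearMapAt ℝ m (X m)
      = chartD p m (X m) := by rw [h2]; rfl
  rw [← h3, Bundle.Trivialization.continuousLinearMapAt_apply,
    Bundle.Trivialization.linearMapAt_apply, if_pos]
  rwa [TangentBundle.trivializationAt_baseSet]

theorem contMDiffOn_frame (p : M) (i : Fin 2) :
    ContMDiffOn (𝓡 2) (𝓡 2).tangent ∞
      (fun m => (⟨m, frame p m i⟩ : TangentBundle (𝓡 2) M)) (extChartAt (𝓡 2) p).source := by
  rw [contMDiffOn_field_iff le_rfl]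
  exact contMDiffOn_const.congr fun m hm => chartD_frame hm i

theorem contDiffOn_comp {n : ℕ∞ω} {X : ∀ x : M, TangentSpace (𝓡 2) x}
    (hX : IsField n X) (p : M) (i : Fin 2) (hn : n ≤ ∞) :
    ContDiffOn ℝ n (comp X p i) (extChartAt (𝓡 2) p).target := by
  have h := ((contMDiffOn_field_iff hn p).1 hX.contMDiffOn).comp
    ((contMDiffOn_extChartAt_symm p).of_le hn) fun y hy => (extChartAt (𝓡 2) p).map_target hy
  exact (EuclideanSpace.proj i : E2 →L[ℝ] ℝ).contDiff.comp_contDiffOn h.contDiffOn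

variable (g : Metric M)

theorem gram_eq_inner {y : E2} (h : (extChartAt (𝓡 2) p).symm y = m) (i j : Fin 2) :
    gram g p y i j = g.inner m (frame p m i) (frame p m j) := by
  subst h; rfl

/-- The transformation law of the metric. -/
theorem gram_transform {y : E2} (hy : y ∈ overlap p q) (a b : Fin 2) :
    gram g q y a b = ∑ c, ∑ d, pd a (fun z => transition p q z c) y
      * pd b (fun z => transition p q z d) y * gram g p (transition p q y) c d := by
  have hm := (extChartAt (𝓡 2) q).map_target hy.1
  have ha := frame_transform hy.2 hm a
  have hb := frame_transform hy.2 hm b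
  rw [(extChartAt (𝓡 2) q).right_inv hy.1] at ha hb
  simp only [gram_eq_inner g (symm_transition hy), gram_eq_inner g rfl, ha, hb, Fin.sum_univ_two,
    map_add, map_smul, add_apply, smul_apply, smul_eq_mul]
  ring

theorem inner_eq_gram (hp : m ∈ (extChartAt (𝓡 2) p).source) (v w : TangentSpace (𝓡 2) m) :
    g.inner m v w = ∑ i, ∑ j, gram g p (extChartAt (𝓡 2) p m) i j
      * chartD p m v i * chartD p m w j := by
  conv_lhs => rw [eq_sum_frame hp v, eq_sum_frame hp w]
  simp only [gram_eq_inner g ((extChartAt (𝓡 2) p).left_inv hp), Fin.sum_univ_two, map_add,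
    map_smul, add_apply, smul_apply, smul_eq_mul]
  ring

theorem contDiffOn_gram (p : M) (i j : Fin 2) :
    ContDiffOn ℝ ∞ (fun y => gram g p y i j) (extChartAt (𝓡 2) p).target := by
  have h : ContMDiffOn (𝓡 2) 𝓘(ℝ, ℝ) ∞ (fun m => g.inner m (frame p m i) (frame p m j))
      (extChartAt (𝓡 2) p).source := by
    intro m hm
    have := ContMDiffWithinAt.clm_bundle_apply₂ (F₁ := E2) (F₂ := E2)
      (E₃ := fun _ : M => ℝ) (F₃ := ℝ)
      (g.contMDiff.contMDiffAt.contMDiffWithinAt (x := m) (s := (extChartAt (𝓡 2) p).source))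
      (contMDiffOn_frame p i m hm) (contMDiffOn_frame p j m hm)
    simp only [Bundle.contMDiffWithinAt_totalSpace] at this
    exact this.2
  exact (h.comp (contMDiffOn_extChartAt_symm p)
    fun y hy => (extChartAt (𝓡 2) p).map_target hy).contDiffOn

theorem isMetricOn_gram (p : M) : IsMetricOn (gram g p) (extChartAt (𝓡 2) p).target where
  isOpen := isOpen_extChartAt_target p
  symm y _ i j := g.symm _ _ _
  det_pos y hy := by
    have hm := (extChartAt (𝓡 2) p).map_target hy
    have hpos : ∀ a b : ℝ, (a ≠ 0 ∨ b ≠ 0) → 0 < a * a * gram g p y 0 0 + a * b * gram g p y 0 1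
        + b * a * gram g p y 1 0 + b * b * gram g p y 1 1 := by
      intro a b hab
      have hv : a • frame p ((extChartAt (𝓡 2) p).symm y) 0
          + b • frame p ((extChartAt (𝓡 2) p).symm y) 1 ≠ 0 := by
        intro h0
        have := congrArg (chartD p ((extChartAt (𝓡 2) p).symm y)) h0
        rw [map_add, map_smul, map_smul, chartD_frame hm, chartD_frame hm, map_zero] at this
        have e0 := congrFun (congrArg WithLp.ofLp this) 0
        have e1 := congrFun (congrArg WithLp.ofLp this) 1
        simp at e0 e1
        simp_all
      have := g.pos _ _ hv
      simp only [map_add, map_smul, add_apply, smul_apply, smul_eq_mul] at this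
      simp only [gram_eq_inner g rfl]
      linarith
    have h0 := hpos 1 0 (by simp)
    have hs : gram g p y 1 0 = gram g p y 0 1 := g.symm _ _ _
    -- the quadratic form at `(-g₀₁, g₀₀)` is `g₀₀ det g`
    have h1 := hpos (-gram g p y 0 1) (gram g p y 0 0) (Or.inr (by linarith))
    rw [Matrix.det_fin_two]
    rw [hs] at h1 ⊢
    have : 0 < gram g p y 0 0 * (gram g p y 0 0 * gram g p y 1 1 - gram g p y 0 1 * gram g p y 0 1)
        := by linarith
    exact (mul_pos_iff_of_pos_left (by linarith)).1 this
  contDiffOn := contDiffOn_gram g p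

theorem isIsometryOn_transition (p q : M) : IsIsometryOn (transition p q) (gram g p) (gram g q)
    (extChartAt (𝓡 2) p).target (overlap p q) where
  source :=
    { isOpen := isOpen_overlap p q
      symm := fun y hy => (isMetricOn_gram g q).symm y hy.1
      det_pos := fun y hy => (isMetricOn_gram g q).det_pos y hy.1
      contDiffOn := fun i j => ((isMetricOn_gram g q).contDiffOn i j).mono Set.inter_subset_left }
  target := isMetricOn_gram g p
  contDiffOn := contDiffOn_transition p q
  mapsTo _ hy := transition_mem hy
  pullback _ hy := gram_transform g hy

end

/-! ### Invariance of the covariant derivative, and the maximum principle for fields -/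

section

variable {M : Type*} [TopologicalSpace M] [ChartedSpace E2 M] [IsManifold (𝓡 2) ∞ M]
  (g : Metric M) {p q m : M}

/-- The divergence may be computed in any chart. -/
theorem divergence_eq {X : ∀ x : M, TangentSpace (𝓡 2) x}
    (hX : ∀ q i, ContDiffOn ℝ 1 (comp X q i) (extChartAt (𝓡 2) q).target)
    (hp : m ∈ (extChartAt (𝓡 2) p).source) :
    divergence g X m = covM (gram g p) (comp X p) 0 0 (extChartAt (𝓡 2) p m)
      + covM (gram g p) (comp X p) 1 1 (extChartAt (𝓡 2) p m) := by
  have hm := mem_extChartAt_source (I := 𝓡 2) m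
  have hy := mem_overlap hp hm
  have hd : ∀ q i, ∀ y ∈ (extChartAt (𝓡 2) q).target, DifferentiableAt ℝ (comp X q i) y :=
    fun q i y hy => differentiableAt_of_contDiffOn (isOpen_extChartAt_target q) (hX q i)
      one_ne_zero hy
  have h := (isIsometryOn_transition g p m).trace_covM hy (X := comp X p) (X' := comp X m)
    (fun a => hd p a _ (transition_mem hy)) (fun a => hd m a _ hy.1)
    (fun z hz a => comp_transform X hz a)
  rw [transition_extChartAt hm] at h
  rw [h]
  simp only [divergence, Matrix.trace, Fin.sum_univ_two]
  rfl

/-- The covariant derivative may be computed in any chart. -/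
theorem chartD_covDeriv (X : ∀ x : M, TangentSpace (𝓡 2) x) {Y : ∀ x : M, TangentSpace (𝓡 2) x}
    (hY : ∀ q i, ContDiffOn ℝ 1 (comp Y q i) (extChartAt (𝓡 2) q).target)
    (hp : m ∈ (extChartAt (𝓡 2) p).source) (a : Fin 2) :
    chartD p m (covDeriv g X Y m) a = ∑ b, covM (gram g p) (comp Y p) a b (extChartAt (𝓡 2) p m)
      * comp X p b (extChartAt (𝓡 2) p m) := by
  have hm := mem_extChartAt_source (I := 𝓡 2) m
  have hy := mem_overlap hp hm
  have hd : ∀ q i, ∀ y ∈ (extChartAt (𝓡 2) q).target, DifferentiableAt ℝ (comp Y q i) y :=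
    fun q i y hy => differentiableAt_of_contDiffOn (isOpen_extChartAt_target q) (hY q i)
      one_ne_zero hy
  have h := fun j => (isIsometryOn_transition g p m).covM_transform hy (X := comp Y p)
    (X' := comp Y m) (fun a => hd p a _ (transition_mem hy)) (fun a => hd m a _ hy.1)
    (fun z hz a => comp_transform Y hz a) a j
  have hX := fun b => comp_transform X hy b
  rw [transition_extChartAt hm] at h hX
  have hf : ∀ i, chartD p m (frame m m i) a
      = pd i (fun z => transition p m z a) (extChartAt (𝓡 2) m m) := by
    intro i
    rw [chartD_transform hp hm, chartD_frame hm, Fin.sum_univ_two]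
    fin_cases i <;> simp
  have e : chartD p m (covDeriv g X Y m) a = ∑ i, (∑ j, covM (gram g m) (comp Y m) i j
      (extChartAt (𝓡 2) m m) * comp X m j (extChartAt (𝓡 2) m m)) * chartD p m (frame m m i) a := by
    simp only [covDeriv, Fin.sum_univ_two, map_add, map_smul]
    rfl
  have h0 := h 0
  have h1 := h 1
  rw [e]
  simp only [hf, hX, Fin.sum_univ_two] at h0 h1 ⊢
  linear_combination - comp X m 0 (extChartAt (𝓡 2) m m) * h0
    - comp X m 1 (extChartAt (𝓡 2) m m) * h1

/-- The components of the covariant derivative. -/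
theorem comp_covDeriv (X : ∀ x : M, TangentSpace (𝓡 2) x) {Y : ∀ x : M, TangentSpace (𝓡 2) x}
    (hY : ∀ q i, ContDiffOn ℝ 1 (comp Y q i) (extChartAt (𝓡 2) q).target)
    {y : E2} (hy : y ∈ (extChartAt (𝓡 2) p).target) (a : Fin 2) :
    comp (covDeriv g X Y) p a y = ∑ b, covM (gram g p) (comp Y p) a b y * comp X p b y := by
  rw [comp_apply, chartD_covDeriv g X hY ((extChartAt (𝓡 2) p).map_target hy),
    (extChartAt (𝓡 2) p).right_inv hy]

theorem IsMetricOn.contDiffOn_covM {G : E2 → Matrix (Fin 2) (Fin 2) ℝ} {U : Set E2}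
    (hG : IsMetricOn G U) {X : Fin 2 → E2 → ℝ} {n k : ℕ∞ω} (hX : ∀ i, ContDiffOn ℝ n (X i) U)
    (hkn : k + 1 ≤ n) (hk : k ≤ ∞) (i j : Fin 2) : ContDiffOn ℝ k (covM G X i j) U :=
  (contDiffOn_pd j hG.isOpen (hX i) hkn).add <| ContDiffOn.sum fun l _ =>
    ((hG.contDiffOn_chr i j l).of_le hk).mul ((hX l).of_le (le_self_add.trans hkn))

/-- A field on a compact surface vanishes if it does so wherever its covariant derivative is
degenerate: at a maximum of the length of `X`, the image of `∇X` is orthogonal to `X`. -/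
theorem eq_zero_of_det_eq_zero [CompactSpace M] {X : ∀ x : M, TangentSpace (𝓡 2) x}
    (hX : IsField 1 X)
    (h : ∀ x, (covMatrix g X x (extChartAt (𝓡 2) x x)).det = 0 → X x = 0) (x : M) : X x = 0 := by
  have hcont : Continuous fun q => g.inner q (X q) (X q) := by
    have : ContMDiff (𝓡 2) 𝓘(ℝ, ℝ) 1 (fun q => g.inner q (X q) (X q)) := by
      intro q
      have := ContMDiffAt.clm_bundle_apply₂ (F₁ := E2) (F₂ := E2)
        (E₃ := fun _ : M => ℝ) (F₃ := ℝ)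
        (g.contMDiff.contMDiffAt.of_le (x := q) (by simp : (1 : ℕ∞ω) ≤ ∞)) hX.contMDiffAt
        hX.contMDiffAt
      simp only [Bundle.contMDiffAt_totalSpace] at this
      exact this.2
    exact this.continuous
  have : Nonempty M := ⟨x⟩
  obtain ⟨p, hp⟩ := isCompact_univ.exists_isMaxOn (f := fun q => g.inner q (X q) (X q))
    Set.univ_nonempty hcont.continuousOn
  have hpm := mem_extChartAt_source (I := 𝓡 2) p
  set y := extChartAt (𝓡 2) p p with hy
  have hyt : y ∈ (extChartAt (𝓡 2) p).target := mem_extChartAt_target p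
  have hG := isMetricOn_gram g p
  set G := gram g p
  set C := comp X p
  set Φ : E2 → ℝ := fun z => (G z 0 0 * (C 0 z * C 0 z) + G z 0 1 * (C 0 z * C 1 z))
      + (G z 1 0 * (C 1 z * C 0 z) + G z 1 1 * (C 1 z * C 1 z)) with hΦ
  have hΦe : ∀ m ∈ (extChartAt (𝓡 2) p).source,
      g.inner m (X m) (X m) = Φ (extChartAt (𝓡 2) p m) := by
    intro m hm
    rw [inner_eq_gram g hm]
    simp only [← comp_extChartAt X hm, Fin.sum_univ_two, hΦ]
    ring
  have hmax : IsLocalMax Φ y := by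
    filter_upwards [(isOpen_extChartAt_target p).mem_nhds hyt] with z hz
    have h1 := hΦe _ ((extChartAt (𝓡 2) p).map_target hz)
    rw [(extChartAt (𝓡 2) p).right_inv hz] at h1
    rw [← h1, hy, ← hΦe p hpm]
    exact hp.2 (Set.mem_univ _)
  have hpd : ∀ k, pd k Φ y = 0 := fun k => by simp [pd, hmax.fderiv_eq_zero]
  have hC : ∀ i, DifferentiableAt ℝ (C i) y := fun i => differentiableAt_of_contDiffOn
    (isOpen_extChartAt_target p) (contDiffOn_comp (n := 1) hX p i (by simp)) one_ne_zero hyt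
  have hg := hG.differentiableAt hyt
  have ht : ∀ i j, DifferentiableAt ℝ (fun z => G z i j * (C i z * C j z)) y := fun i j =>
    (hg i j).fun_mul ((hC i).fun_mul (hC j))
  have hk : ∀ k, (G y 0 0 * C 0 y + G y 0 1 * C 1 y) * covM G C 0 k y
      + (G y 1 0 * C 0 y + G y 1 1 * C 1 y) * covM G C 1 k y = 0 := by
    intro k
    have h0 := hpd k
    have hs : G y 1 0 = G y 0 1 := hG.symm y hyt 1 0
    rw [hΦ, pd_add k ((ht 0 0).fun_add (ht 0 1)) ((ht 1 0).fun_add (ht 1 1)),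
      pd_add k (ht 0 0) (ht 0 1), pd_add k (ht 1 0) (ht 1 1)] at h0
    simp only [pd_mul k (hg _ _) ((hC _).fun_mul (hC _)), pd_mul k (hC _) (hC _),
      hG.pd_eq hyt] at h0
    simp only [hs] at h0
    simp only [covM, Fin.sum_univ_two, hs]
    linear_combination (1 / 2) * h0
  have hXp : X p = 0 := by
    by_contra hne
    have hdet : covM G C 0 0 y * covM G C 1 1 y - covM G C 0 1 y * covM G C 1 0 y ≠ 0 := by
      intro h0
      refine hne (h p ?_)
      rw [Matrix.det_fin_two]; exact h0
    have k0 := hk 0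
    have k1 := hk 1
    have u0 : G y 0 0 * C 0 y + G y 0 1 * C 1 y = 0 := by
      refine mul_left_cancel₀ hdet ?_
      linear_combination covM G C 1 1 y * k0 - covM G C 1 0 y * k1
    have u1 : G y 1 0 * C 0 y + G y 1 1 * C 1 y = 0 := by
      refine mul_left_cancel₀ hdet ?_
      linear_combination covM G C 0 0 y * k1 - covM G C 0 1 y * k0
    have hC0 := hG.eq_of_sum_mul_eq hyt (a := fun i => C i y) (b := 0) (fun l => by
      fin_cases l
      · simpa using u0
      · simpa using u1)
    apply hne
    apply chartD_injective hpm
    rw [map_zero]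
    ext i
    rw [← comp_extChartAt X hpm]
    exact congrFun hC0 i
  by_contra hne
  have h1 := g.pos x (X x) hne
  have h2 : g.inner x (X x) (X x) ≤ g.inner p (X p) (X p) := hp.2 (Set.mem_univ x)
  rw [hXp] at h2
  simp only [map_zero] at h2
  linarith

end

/-! ### Test functions and weak derivatives -/

section

/-- `a` is a function of class `C^n` with compact support contained in `U`. -/
structure IsTest (n : ℕ∞ω) (U : Set E2) (a : E2 → ℝ) : Prop where
  contDiff : ContDiff ℝ n a
  compact : HasCompactSupport a
  tsupport_subset : tsupport a ⊆ U

variable {n : ℕ∞ω} {U : Set E2} {a b f : E2 → ℝ}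

namespace IsTest

theorem of_le (ha : IsTest n U a) {k : ℕ∞ω} (hk : k ≤ n) : IsTest k U a :=
  ⟨ha.contDiff.of_le hk, ha.compact, ha.tsupport_subset⟩

theorem eq_zero (ha : IsTest n U a) {y : E2} (hy : y ∉ U) : a y = 0 :=
  image_eq_zero_of_notMem_tsupport fun h => hy (ha.tsupport_subset h)

theorem mul (ha : IsTest n U a) (hU : IsOpen U) (hb : ContDiffOn ℝ n b U) :
    IsTest n U (fun y => a y * b y) := by
  have hsub : tsupport (fun y => a y * b y) ⊆ tsupport a := tsupport_mul_subset_left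
  refine ⟨contDiff_iff_contDiffAt.2 fun y => ?_, ha.compact.mul_right,
    hsub.trans ha.tsupport_subset⟩
  by_cases hy : y ∈ tsupport a
  · exact ha.contDiff.contDiffAt.mul (hb.contDiffAt (hU.mem_nhds (ha.tsupport_subset hy)))
  · have : (fun y => a y * b y) =ᶠ[𝓝 y] fun _ => 0 := by
      filter_upwards [(isClosed_tsupport a).isOpen_compl.mem_nhds hy] with z hz
      rw [image_eq_zero_of_notMem_tsupport hz, zero_mul]
    exact contDiffAt_const.congr_of_eventuallyEq this

theorem isTest_pd (ha : IsTest n U a) {k : ℕ∞ω} (hk : k + 1 ≤ n) (i : Fin 2) :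
    IsTest k U (pd i a) where
  contDiff := (ha.contDiff.fderiv_right hk).clm_apply contDiff_const
  compact := ha.compact.fderiv_apply ℝ _
  tsupport_subset := (tsupport_fderiv_apply_subset ℝ _).trans ha.tsupport_subset

theorem integrable (ha : IsTest n U a) : Integrable a :=
  ha.contDiff.continuous.integrable_of_hasCompactSupport ha.compact

theorem integrable_mul (ha : IsTest n U a) (hU : IsOpen U) (hb : ContinuousOn b U) :
    Integrable (fun y => a y * b y) :=
  ((ha.of_le (zero_le (a := n))).mul hU (contDiffOn_zero.2 hb)).integrable

theorem differentiableAt (ha : IsTest 1 U a) (y : E2) : DifferentiableAt ℝ a y :=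
  ha.contDiff.differentiable one_ne_zero y

/-- Integration by parts. -/
theorem integral_pd_mul (ha : IsTest 1 U a) (hU : IsOpen U) (hb : ContDiffOn ℝ 1 b U) (i : Fin 2) :
    ∫ y, pd i a y * b y = - ∫ y, a y * pd i b y := by
  have h := integral_mul_fderiv_eq_neg_fderiv_mul_of_integrable (μ := volume) (f := a) (g := b)
    (v := EuclideanSpace.single i 1)
    ((ha.isTest_pd (k := 0) (by simp) i).integrable_mul hU hb.continuousOn)
    (ha.integrable_mul hU (contDiffOn_pd (m := 0) i hU hb (by simp)).continuousOn)
    (ha.integrable_mul hU hb.continuousOn) (fun x _ => ha.differentiableAt x)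
    (fun x hx => differentiableAt_of_contDiffOn hU hb one_ne_zero (ha.tsupport_subset hx))
  change ∫ y, fderiv ℝ a y _ * b y = - ∫ y, a y * fderiv ℝ b y _
  rw [h, neg_neg]

theorem lineDeriv_eq (ha : IsTest 1 U a) (i : Fin 2) (y : E2) :
    lineDeriv ℝ a y (EuclideanSpace.single i 1) = pd i a y :=
  (ha.differentiableAt y).lineDeriv_eq_fderiv

theorem lineDeriv_neg_eq (ha : IsTest 1 U a) (i : Fin 2) (y : E2) :
    lineDeriv ℝ a y (-EuclideanSpace.single i 1) = - pd i a y := by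
  rw [(ha.differentiableAt y).lineDeriv_eq_fderiv, map_neg]; rfl

/-- Mixed second derivatives commute in the weak sense: the functions need only be `C¹`.
The derivative `∂ᵢ` is approximated by difference quotients, which commute with `∂ⱼ`. -/
theorem integral_pd_mul_pd_comm_aux {V : Set E2} (ha : IsTest 1 U a) (hb : IsTest 1 V b)
    (i j : Fin 2) : ∫ y, pd i a y * pd j b y = ∫ y, pd j a y * pd i b y := by
  set v : E2 := EuclideanSpace.single i 1 with hv
  obtain ⟨C, hC⟩ := ContDiff.lipschitzWith_of_hasCompactSupport ha.compact ha.contDiff one_ne_zero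
  obtain ⟨D, hD⟩ := ContDiff.lipschitzWith_of_hasCompactSupport hb.compact hb.contDiff one_ne_zero
  have A := hC.integral_inv_smul_sub_mul_tendsto_integral_lineDeriv_mul' (μ := volume) ha.compact
    (hb.isTest_pd (k := 0) (by simp) j).contDiff.continuous v
  have B := hD.integral_inv_smul_sub_mul_tendsto_integral_lineDeriv_mul' (μ := volume) hb.compact
    (ha.isTest_pd (k := 0) (by simp) j).contDiff.continuous (-v)
  simp only [hv, ha.lineDeriv_eq, hb.lineDeriv_neg_eq] at A B
  have hshift : ∀ w : E2, IsTest 1 Set.univ fun y => a (y + w) := fun w =>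
    ⟨ha.contDiff.comp (contDiff_id.add contDiff_const),
      ha.compact.comp_homeomorph (Homeomorph.addRight w), Set.subset_univ _⟩
  have hpd : ∀ w y, pd j (fun y => a (y + w)) y = pd j a (y + w) := by
    intro w y
    simp only [SurfaceFlow.pd, fderiv_comp_add_right]
  have hbU : ContDiffOn ℝ 1 b Set.univ := hb.contDiff.contDiffOn
  have hbc : ContinuousOn b Set.univ := hbU.continuousOn
  have hpb : ContinuousOn (pd j b) Set.univ :=
    (hb.isTest_pd (k := 0) (by simp) j).contDiff.continuous.continuousOn
  have hau : IsTest 1 Set.univ a := ⟨ha.contDiff, ha.compact, Set.subset_univ _⟩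
  -- summation by parts for the difference quotient, and integration by parts for `∂ⱼ`
  have key : ∀ t : ℝ, ∫ y, (t⁻¹ • (a (y + t • v) - a y)) * pd j b y
      = - ∫ y, (t⁻¹ • (b (y + t • -v) - b y)) * pd j a y := by
    intro t
    have e1 : ∫ y, a (y + t • v) * pd j b y
        = - ∫ y, pd j a y * b (y + t • -v) := by
      have := (hshift (t • v)).integral_pd_mul isOpen_univ hbU j
      simp only [hpd] at this
      have h2 : ∫ y, pd j a (y + t • v) * b y
          = ∫ y, pd j a y * b (y + t • -v) := by
        rw [← integral_add_right_eq_self _ (t • -v)]; simp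
      rw [← h2, this, neg_neg]
    have e2 := hau.integral_pd_mul isOpen_univ hbU j
    have i1 := (hshift (t • v)).integrable_mul isOpen_univ hpb
    have i2 := hau.integrable_mul isOpen_univ hpb
    have i3 : Integrable fun y => pd j a y * b (y + t • -v) :=
      (hau.isTest_pd (k := 0) (by simp) j).integrable_mul isOpen_univ
        (hb.contDiff.continuous.comp (continuous_add_const _)).continuousOn
    have i4 := (hau.isTest_pd (k := 0) (by simp) j).integrable_mul isOpen_univ hbc
    have l1 : ∫ y, (t⁻¹ • (a (y + t • v) - a y)) * pd j b y
        = t⁻¹ * ((∫ y, a (y + t • v) * pd j b y) - ∫ y, a y * pd j b y) := by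
      rw [← integral_sub i1 i2, ← integral_const_mul]
      congr 1; funext y; simp only [smul_eq_mul]; ring
    have l2 : ∫ y, (t⁻¹ • (b (y + t • -v) - b y)) * pd j a y
        = t⁻¹ * ((∫ y, pd j a y * b (y + t • -v))
          - ∫ y, pd j a y * b y) := by
      rw [← integral_sub i3 i4, ← integral_const_mul]
      congr 1; funext y; simp only [smul_eq_mul]; ring
    rw [l1, l2, e1, e2]; ring
  simp only [hv] at key
  simp only [key] at A
  have := tendsto_nhds_unique A B.neg
  rw [this, ← integral_neg]
  congr 1; funext y; ring

theorem exists_cutoff (ha : IsTest n U a) (hU : IsOpen U) :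
    ∃ χ : E2 → ℝ, IsTest ∞ U χ ∧ ∀ y ∈ tsupport a, χ =ᶠ[𝓝 y] fun _ => 1 := by
  obtain ⟨L, hL, hKL, hLU⟩ := exists_compact_between ha.compact hU ha.tsupport_subset
  obtain ⟨χ, h1, h2, -⟩ := exists_contMDiffMap_one_nhds_of_subset_interior 𝓘(ℝ, E2) (n := ⊤)
    (isClosed_tsupport a) hKL
  have hsub : tsupport χ ⊆ L := closure_minimal
    (fun y hy => by_contra fun hL => hy (h2 y hL)) hL.isClosed
  exact ⟨χ, ⟨χ.contMDiff.contDiff, hL.of_isClosed_subset (isClosed_tsupport _) hsub,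
    hsub.trans hLU⟩, fun y hy => (eventually_nhdsSet_iff_forall.1 h1) y hy⟩

/-- Mixed second derivatives commute in the weak sense, for a `C¹` function on an open set. -/
theorem integral_pd_mul_pd_comm (ha : IsTest 1 U a) (hU : IsOpen U) (hb : ContDiffOn ℝ 1 b U)
    (i j : Fin 2) : ∫ y, pd i a y * pd j b y = ∫ y, pd j a y * pd i b y := by
  obtain ⟨χ, hχ, hχ1⟩ := ha.exists_cutoff hU
  have h := ha.integral_pd_mul_pd_comm_aux ((hχ.of_le (by simp)).mul hU hb) i j
  have e : ∀ k l y, pd k a y * pd l (fun y => χ y * b y) y = pd k a y * pd l b y := by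
    intro k l y
    by_cases hy : y ∈ tsupport a
    · congr 1
      refine pd_congr l ?_
      filter_upwards [hχ1 y hy] with z hz
      rw [hz, one_mul]
    · rw [pd_eq_zero_of_notMem_tsupport k hy, zero_mul, zero_mul]
  simpa only [e] using h

/-- A continuous function that integrates to zero against all smooth test functions vanishes. -/
theorem eq_zero_of_integral_eq_zero (hU : IsOpen U) (hf : ContinuousOn f U)
    (h : ∀ a, IsTest ∞ U a → ∫ y, a y * f y = 0) : ∀ y ∈ U, f y = 0 := by
  have h1 := hU.ae_eq_zero_of_integral_contDiff_smul_eq_zero (μ := volume)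
    (hf.locallyIntegrableOn hU.measurableSet) fun a h1 h2 h3 => h a ⟨h1, h2, h3⟩
  have h2 : f =ᵐ[volume.restrict U] fun _ => 0 := (ae_restrict_iff' hU.measurableSet).2 h1
  exact Measure.eqOn_open_of_ae_eq h2 hU hf continuousOn_const

end IsTest

end

/-! ### The curvature identity for divergence-free fields in a chart -/

section

variable {U : Set E2} {a : E2 → ℝ} {G : E2 → Matrix (Fin 2) (Fin 2) ℝ}

theorem IsTest.pd_eq_zero {n : ℕ∞ω} (ha : IsTest n U a) {y : E2} (hy : y ∉ U) (i : Fin 2) :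
    pd i a y = 0 :=
  pd_eq_zero_of_notMem_tsupport i fun h => hy (ha.tsupport_subset h)

/-- Moving derivatives between the factors of `∂ᵢa · Y ∂ⱼX` in the weak sense. -/
theorem IsTest.integral_pd_mul_mul_pd (ha : IsTest ∞ U a) (hU : IsOpen U) {X Y : E2 → ℝ}
    (hX : ContDiffOn ℝ 1 X U) (hY : ContDiffOn ℝ 1 Y U) (i j : Fin 2) :
    ∫ y, pd i a y * (Y y * pd j X y) = (∫ y, pd j a y * (Y y * pd i X y))
      + ((∫ y, a y * (pd j Y y * pd i X y)) - ∫ y, a y * (pd i Y y * pd j X y)) := by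
  have h := ((ha.of_le (by simp : (1 : ℕ∞ω) ≤ ∞)).mul hU hY).integral_pd_mul_pd_comm hU hX i j
  have hp : ∀ k {f : E2 → ℝ}, ContDiffOn ℝ 1 f U → ContinuousOn (pd k f) U := fun k f hf =>
    (contDiffOn_pd (m := 0) k hU hf (by simp)).continuousOn
  have e : ∀ k l, ∫ y, pd k (fun y => a y * Y y) y * pd l X y
      = (∫ y, pd k a y * (Y y * pd l X y)) + ∫ y, a y * (pd k Y y * pd l X y) := by
    intro k l
    rw [← integral_add ((ha.isTest_pd (k := 0) (by simp) k).integrable_mul hU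
      (hY.continuousOn.fun_mul (hp l hX))) (ha.integrable_mul hU ((hp k hY).fun_mul (hp l hX)))]
    congr 1
    funext y
    by_cases hy : y ∈ U
    · rw [pd_mul k ((ha.of_le (by simp)).differentiableAt y)
        (differentiableAt_of_contDiffOn hU hY one_ne_zero hy)]
      ring
    · have h1 := ((ha.of_le (by simp : (1 : ℕ∞ω) ≤ ∞)).mul hU hY).pd_eq_zero hy k
      rw [h1, ha.pd_eq_zero hy, ha.eq_zero hy]
      ring
  rw [e, e] at h
  linear_combination h

namespace IsMetricOn

/-- The divergence theorem in a chart. -/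
theorem integral_pd_mul_eq_zero (hG : IsMetricOn G U) (ha : IsTest ∞ U a) {W : Fin 2 → E2 → ℝ}
    (hW : ∀ i, ContDiffOn ℝ 1 (W i) U) (hdiv : ∀ y ∈ U, covM G W 0 0 y + covM G W 1 1 y = 0) :
    ∫ y, (pd 0 a y * W 0 y + pd 1 a y * W 1 y) * Real.sqrt (G y).det = 0 := by
  have hσ := hG.contDiffOn_sqrt_det.of_le (by simp : (1 : ℕ∞ω) ≤ ∞)
  have hY : ∀ i, ContDiffOn ℝ 1 (fun y => W i y * Real.sqrt (G y).det) U := fun i => (hW i).mul hσ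
  have h1 := fun i => (ha.of_le (by simp)).integral_pd_mul hG.isOpen (hY i) i
  have hi := fun i =>
    (ha.isTest_pd (k := 0) (by simp) i).integrable_mul hG.isOpen (hY i).continuousOn
  have hi' := fun i => ha.integrable_mul hG.isOpen
    (contDiffOn_pd (m := 0) i hG.isOpen (hY i) (by simp)).continuousOn
  have e : (fun y => (pd 0 a y * W 0 y + pd 1 a y * W 1 y) * Real.sqrt (G y).det)
      = fun y => pd 0 a y * (W 0 y * Real.sqrt (G y).det)
        + pd 1 a y * (W 1 y * Real.sqrt (G y).det) := by funext y; ring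
  rw [e, integral_add (hi 0) (hi 1), h1, h1, ← neg_add, ← integral_add (hi' 0) (hi' 1), neg_eq_zero]
  refine integral_eq_zero_of_ae (.of_forall fun y => ?_)
  simp only [Pi.zero_apply]
  by_cases hy : y ∈ U
  · have hd : ∀ i, DifferentiableAt ℝ (W i) y := fun i =>
      differentiableAt_of_contDiffOn hG.isOpen (hW i) one_ne_zero hy
    have hdσ := differentiableAt_of_contDiffOn hG.isOpen hσ one_ne_zero hy
    have hd0 := hdiv y hy
    rw [pd_mul 0 (hd 0) hdσ, pd_mul 1 (hd 1) hdσ, hG.pd_sqrt_det hy, hG.pd_sqrt_det hy]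
    simp only [covM, Fin.sum_univ_two, hG.chr_symm hy 0 1 0, hG.chr_symm hy 1 1 0] at hd0 ⊢
    linear_combination a y * Real.sqrt (G y).det * hd0
  · rw [ha.eq_zero hy]; ring

/-- A divergence-free `C¹` field `X` for which `∇_X X` is divergence-free in the weak sense
satisfies `tr (∇X)² + K |X|² = 0` at every point. In the weak equation, exchanging `∂ᵢ` and `∂ⱼ` in
`∂ᵢa Xʲ ∂ⱼXⁱ` produces the Euclidean divergence `∂ᵢXⁱ`, which by `div X = 0` is an expression
without derivatives of `X` and so may be differentiated once more. -/
theorem trace_sq_add_curvature (hG : IsMetricOn G U) {X : Fin 2 → E2 → ℝ}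
    (hX : ∀ i, ContDiffOn ℝ 1 (X i) U) (hdiv : ∀ y ∈ U, covM G X 0 0 y + covM G X 1 1 y = 0)
    (hweak : ∀ a, IsTest ∞ U a → ∫ y, (pd 0 a y * (∑ j, covM G X 0 j y * X j y)
      + pd 1 a y * (∑ j, covM G X 1 j y * X j y)) * Real.sqrt (G y).det = 0)
    {y : E2} (hy : y ∈ U) :
    covM G X 0 0 y ^ 2 + 2 * covM G X 0 1 y * covM G X 1 0 y + covM G X 1 1 y ^ 2
      + (∑ l, G y l 0 * riem G l 1 0 1 y) / (G y).det * (∑ i, ∑ j, G y i j * X i y * X j y)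
      = 0 := by
  have hU := hG.isOpen
  set σ : E2 → ℝ := fun y => Real.sqrt (G y).det with hσd
  have hσ : ContDiffOn ℝ 1 σ U := hG.contDiffOn_sqrt_det.of_le (by simp)
  have hΓ : ∀ k i j, ContDiffOn ℝ 1 (chr G k i j) U := fun k i j =>
    (hG.contDiffOn_chr k i j).of_le (by simp)
  set Y : Fin 2 → E2 → ℝ := fun i y => σ y * X i y with hYd
  have hY : ∀ i, ContDiffOn ℝ 1 (Y i) U := fun i => hσ.mul (hX i)
  -- the terms of `∇_X X` that are products of continuously differentiable functions, together with
  -- `X` times the Euclidean divergence of `X`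
  set R : Fin 2 → E2 → ℝ := fun i y =>
    -(((chr G 0 0 0 y + chr G 1 0 1 y) * X 0 y + (chr G 0 1 0 y + chr G 1 1 1 y) * X 1 y) * X i y)
      + (((chr G i 0 0 y * X 0 y + chr G i 0 1 y * X 1 y) * X 0 y)
      + ((chr G i 1 0 y * X 0 y + chr G i 1 1 y * X 1 y) * X 1 y)) with hRd
  have hR : ∀ i, ContDiffOn ℝ 1 (R i) U := fun i =>
    ((((((hΓ _ _ _).add (hΓ _ _ _)).mul (hX _)).add (((hΓ _ _ _).add (hΓ _ _ _)).mul
      (hX _))).mul (hX _)).neg).add (((((hΓ _ _ _).mul (hX _)).add ((hΓ _ _ _).mul (hX _))).mul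
      (hX _)).add ((((hΓ _ _ _).mul (hX _)).add ((hΓ _ _ _).mul (hX _))).mul (hX _)))
  set S : Fin 2 → E2 → ℝ := fun i y =>
      σ y * (((chr G i 0 0 y * X 0 y + chr G i 0 1 y * X 1 y) * X 0 y)
      + ((chr G i 1 0 y * X 0 y + chr G i 1 1 y * X 1 y) * X 1 y)) with hSd
  have hS : ∀ i, ContDiffOn ℝ 1 (S i) U := fun i =>
    hσ.mul (((((hΓ _ _ _).mul (hX _)).add ((hΓ _ _ _).mul (hX _))).mul
      (hX _)).add ((((hΓ _ _ _).mul (hX _)).add ((hΓ _ _ _).mul (hX _))).mul (hX _)))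
  have hp : ∀ k {f : E2 → ℝ}, ContDiffOn ℝ 1 f U → ContinuousOn (pd k f) U := fun k f hf =>
    (contDiffOn_pd (m := 0) k hU hf (by simp)).continuousOn
  set P : Fin 2 → E2 → ℝ := fun i y => σ y * R i y with hPd
  have hP : ∀ i, ContDiffOn ℝ 1 (P i) U := fun i => hσ.mul (hR i)
  set Q : E2 → ℝ := fun y => (pd 1 (Y 1) y * pd 0 (X 0) y - pd 0 (Y 1) y * pd 1 (X 0) y)
    + (pd 0 (Y 0) y * pd 1 (X 1) y - pd 1 (Y 0) y * pd 0 (X 1) y) with hQd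
  have hq : ∀ i j k l, ContinuousOn (fun y => pd i (Y j) y * pd k (X l) y) U := fun i j k l =>
    (hp i (hY j)).mul (hp k (hX l))
  have hQ : ContinuousOn Q U := ((hq _ _ _ _).sub (hq _ _ _ _)).add ((hq _ _ _ _).sub (hq _ _ _ _))
  have hYX : ∀ j k l, ContinuousOn (fun y => Y j y * pd k (X l) y) U := fun j k l =>
    (hY j).continuousOn.mul (hp k (hX l))
  have hdiv' : ∀ z ∈ U, pd 0 (X 0) z + pd 1 (X 1) z = -((chr G 0 0 0 z + chr G 1 0 1 z) * X 0 z
      + (chr G 0 1 0 z + chr G 1 1 1 z) * X 1 z) := by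
    intro z hz
    have := hdiv z hz
    simp only [covM, Fin.sum_univ_two, hG.chr_symm hz 0 0 1, hG.chr_symm hz 1 1 0] at this
    linear_combination this
  -- the weak equation with all derivatives removed from the test function: `∂ᵢ(σ Rⁱ) = Q`
  have main : ∀ a, IsTest ∞ U a → ∫ y, a y * (Q y - pd 0 (P 0) y - pd 1 (P 1) y) = 0 := by
    intro a ha
    have hd := fun i => ha.isTest_pd (k := 0) (by simp) i
    have h0 := hweak a ha
    have e : (fun y => (pd 0 a y * (∑ j, covM G X 0 j y * X j y)
        + pd 1 a y * (∑ j, covM G X 1 j y * X j y)) * Real.sqrt (G y).det)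
        = fun y => ((pd 0 a y * (Y 0 y * pd 0 (X 0) y) + pd 0 a y * (Y 1 y * pd 1 (X 0) y))
          + (pd 1 a y * (Y 0 y * pd 0 (X 1) y) + pd 1 a y * (Y 1 y * pd 1 (X 1) y)))
          + (pd 0 a y * S 0 y + pd 1 a y * S 1 y) := by
      funext y
      simp only [covM, Fin.sum_univ_two, hYd, hSd, hσd]
      ring
    have i1 := fun i j k l => (hd i).integrable_mul hU (hYX j k l)
    have i2 := fun i => (hd i).integrable_mul hU (hS i).continuousOn
    have i3 := fun i j k l => ha.integrable_mul hU (hq i j k l)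
    rw [e, integral_add
      (((i1 0 0 0 0).fun_add (i1 0 1 1 0)).fun_add ((i1 1 0 0 1).fun_add (i1 1 1 1 1)))
      ((i2 0).fun_add (i2 1)), integral_add ((i1 0 0 0 0).fun_add (i1 0 1 1 0))
      ((i1 1 0 0 1).fun_add (i1 1 1 1 1)), integral_add (i1 0 0 0 0) (i1 0 1 1 0),
      integral_add (i1 1 0 0 1) (i1 1 1 1 1), integral_add (i2 0) (i2 1),
      ha.integral_pd_mul_mul_pd hU (hX 0) (hY 1) 0 1,
      ha.integral_pd_mul_mul_pd hU (hX 1) (hY 0) 1 0] at h0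
    have hPe : ∀ i, ∫ y, pd i a y * P i y = (∫ y, pd i a y * (Y i y * pd 0 (X 0) y))
        + (∫ y, pd i a y * (Y i y * pd 1 (X 1) y)) + ∫ y, pd i a y * S i y := by
      intro i
      rw [← integral_add (i1 i i 0 0) (i1 i i 1 1),
        ← integral_add ((i1 i i 0 0).fun_add (i1 i i 1 1)) (i2 i)]
      congr 1
      funext y
      by_cases hy : y ∈ U
      · simp only [hPd, hRd, hYd, hSd]
        linear_combination - pd i a y * σ y * X i y * hdiv' y hy
      · rw [ha.pd_eq_zero hy]; ring
    have hP1 := fun i => (ha.of_le (by simp)).integral_pd_mul hU (hP i) i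
    have hQe : ∫ y, a y * Q y = ((∫ y, a y * (pd 1 (Y 1) y * pd 0 (X 0) y))
        - ∫ y, a y * (pd 0 (Y 1) y * pd 1 (X 0) y))
        + ((∫ y, a y * (pd 0 (Y 0) y * pd 1 (X 1) y))
        - ∫ y, a y * (pd 1 (Y 0) y * pd 0 (X 1) y)) := by
      have i6 : ∀ i j k l i' j' k' l', Integrable fun y => a y * (pd i (Y j) y * pd k (X l) y)
          - a y * (pd i' (Y j') y * pd k' (X l') y) := fun _ _ _ _ _ _ _ _ =>
        (i3 _ _ _ _).sub (i3 _ _ _ _)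
      rw [← integral_sub (i3 _ _ _ _) (i3 _ _ _ _), ← integral_sub (i3 _ _ _ _) (i3 _ _ _ _),
        ← integral_add (i6 _ _ _ _ _ _ _ _) (i6 _ _ _ _ _ _ _ _)]
      congr 1
      funext y
      simp only [hQd]
      ring
    have i4 := fun i => ha.integrable_mul hU (hp i (hP i))
    have i5 := ha.integrable_mul hU hQ
    have e2 : (fun y => a y * (Q y - pd 0 (P 0) y - pd 1 (P 1) y))
        = fun y => a y * Q y - a y * pd 0 (P 0) y - a y * pd 1 (P 1) y := by funext y; ring
    have i7 : Integrable fun y => a y * Q y - a y * pd 0 (P 0) y := i5.sub (i4 0)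
    rw [e2, integral_sub i7 (i4 1), integral_sub i5 (i4 0)]
    linear_combination h0 + hQe + hPe 0 + hPe 1 - hP1 0 - hP1 1
  have hzero := IsTest.eq_zero_of_integral_eq_zero hU ((hQ.sub (hp 0 (hP 0))).sub (hp 1 (hP 1)))
    main y hy
  have dX : ∀ i, DifferentiableAt ℝ (X i) y := fun i =>
    differentiableAt_of_contDiffOn hU (hX i) one_ne_zero hy
  have dΓ := hG.differentiableAt_chr hy
  have dσ := differentiableAt_of_contDiffOn hU hσ one_ne_zero hy
  have dR := fun i => differentiableAt_of_contDiffOn hU (hR i) one_ne_zero hy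
  have pσ : ∀ k, pd k σ y = σ y * (chr G 0 k 0 y + chr G 1 k 1 y) := hG.pd_sqrt_det hy
  have hσ0 : σ y ≠ 0 := (Real.sqrt_pos.2 (hG.det_pos y hy)).ne'
  have pY : ∀ i k, pd k (Y i) y = σ y * (chr G 0 k 0 y + chr G 1 k 1 y) * X i y
      + σ y * pd k (X i) y := fun i k => by rw [hYd, pd_mul k dσ (dX i), pσ]
  have pP : ∀ i, pd i (P i) y = σ y * (chr G 0 i 0 y + chr G 1 i 1 y) * R i y
      + σ y * pd i (R i) y := fun i => by rw [hPd, pd_mul i dσ (dR i), pσ]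
  have cs : ∀ k, chr G k 1 0 y = chr G k 0 1 y := fun k => hG.chr_symm hy k 1 0
  have ps : ∀ i k, pd i (chr G k 1 0) y = pd i (chr G k 0 1) y := fun i k => pd_congr i <| by
    filter_upwards [hU.mem_nhds hy] with z hz using hG.chr_symm hz k 1 0
  have r00 := hG.ricci_eq hy 0 0
  have r01 := hG.ricci_eq hy 0 1
  have r10 := hG.ricci_eq hy 1 0
  have r11 := hG.ricci_eq hy 1 1
  have hd := hdiv' y hy
  simp only [Pi.sub_apply, hQd, pP, pY] at hzero
  simp only [hRd] at hzero
  simp (disch := fun_prop) only [pd_add, pd_mul, pd_neg] at hzero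
  simp only [Fin.sum_univ_two]
  generalize (G y 0 0 * riem G 0 1 0 1 y + G y 1 0 * riem G 1 1 0 1 y) / (G y).det = κ at *
  simp only [riem, Fin.sum_univ_two, cs, ps] at r00 r01 r10 r11
  simp only [cs, ps] at hzero hd
  simp only [covM, Fin.sum_univ_two, cs]
  refine mul_left_cancel₀ hσ0 ?_
  linear_combination - hzero + σ y * (pd 0 (X 0) y + pd 1 (X 1) y
    + ((chr G 0 0 0 y + chr G 1 0 1 y) * X 0 y + (chr G 0 0 1 y + chr G 1 1 1 y) * X 1 y)) * hd
    - σ y * (X 0 y * X 0 y * r00 + X 0 y * X 1 y * r01 + X 1 y * X 0 y * r10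
      + X 1 y * X 1 y * r11)

end IsMetricOn

end

/-! ### The Riemannian volume in charts -/

section

theorem det_eq_of_fin_two (L : E2 →L[ℝ] E2) :
    L.det = L (EuclideanSpace.single 0 1) 0 * L (EuclideanSpace.single 1 1) 1
      - L (EuclideanSpace.single 1 1) 0 * L (EuclideanSpace.single 0 1) 1 := by
  rw [ContinuousLinearMap.det,
    ← LinearMap.det_toMatrix (EuclideanSpace.basisFun (Fin 2) ℝ).toBasis, Matrix.det_fin_two]
  simp [LinearMap.toMatrix_apply]

variable {M : Type*} [TopologicalSpace M] [ChartedSpace E2 M] [MeasurableSpace M] [BorelSpace M]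
  {p q m : M} {A : Set M}

theorem aemeasurable_extChartAt_symm (p : M) :
    AEMeasurable (extChartAt (𝓡 2) p).symm
      ((volume : Measure E2).restrict (extChartAt (𝓡 2) p).target) :=
  (continuousOn_extChartAt_symm p).aemeasurable (isOpen_extChartAt_target p).measurableSet

theorem measurableSet_preimage_inter_target (p : M) (hA : MeasurableSet A) :
    MeasurableSet ((extChartAt (𝓡 2) p).symm ⁻¹' A ∩ (extChartAt (𝓡 2) p).target) := by
  have h := (continuousOn_iff_continuous_domRestrict.1
    (continuousOn_extChartAt_symm (I := 𝓡 2) p)).measurable hA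
  have := (isOpen_extChartAt_target (I := 𝓡 2) p).measurableSet.subtype_image h
  convert this using 1
  ext y
  simp [and_comm]

variable [IsManifold (𝓡 2) ∞ M] (g : Metric M)

theorem chartVolume_apply (p : M) (hA : MeasurableSet A) :
    chartVolume g p A = ∫⁻ y in (extChartAt (𝓡 2) p).symm ⁻¹' A ∩ (extChartAt (𝓡 2) p).target,
      ENNReal.ofReal (Real.sqrt (gram g p y).det) := by
  rw [chartVolume, Measure.map_apply_of_aemeasurable
    ((aemeasurable_extChartAt_symm p).mono_ac (withDensity_absolutelyContinuous _ _)) hA,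
    withDensity_apply', Measure.restrict_restrict' (isOpen_extChartAt_target p).measurableSet]

theorem chartVolume_inter_source (p : M) (hA : MeasurableSet A) :
    chartVolume g p (A ∩ (extChartAt (𝓡 2) p).source) = chartVolume g p A := by
  rw [chartVolume_apply g p hA,
    chartVolume_apply g p (hA.inter (isOpen_extChartAt_source p).measurableSet)]
  congr 2
  ext y
  simp only [Set.preimage_inter, Set.mem_inter_iff, Set.mem_preimage]
  exact ⟨fun h => ⟨h.1.1, h.2⟩, fun h => ⟨⟨h.1, (extChartAt (𝓡 2) p).map_target h.2⟩, h.2⟩⟩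

/-- The volumes of two charts agree on the intersection of their domains. -/
theorem chartVolume_eq (hA : MeasurableSet A) (hp : A ⊆ (extChartAt (𝓡 2) p).source)
    (hq : A ⊆ (extChartAt (𝓡 2) q).source) : chartVolume g p A = chartVolume g q A := by
  rw [chartVolume_apply g p hA, chartVolume_apply g q hA]
  set S := (extChartAt (𝓡 2) q).symm ⁻¹' A ∩ (extChartAt (𝓡 2) q).target with hS
  have hSo : S ⊆ overlap p q := fun y hy => ⟨hy.2, hp hy.1⟩
  have himg : (extChartAt (𝓡 2) p).symm ⁻¹' A ∩ (extChartAt (𝓡 2) p).target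
      = transition p q '' S := by
    ext z
    constructor
    · rintro ⟨hz, hzt⟩
      refine ⟨extChartAt (𝓡 2) q ((extChartAt (𝓡 2) p).symm z), ⟨?_, ?_⟩, ?_⟩
      · rw [Set.mem_preimage, (extChartAt (𝓡 2) q).left_inv (hq hz)]; exact hz
      · exact (extChartAt (𝓡 2) q).map_source (hq hz)
      · rw [transition_extChartAt (hq hz), (extChartAt (𝓡 2) p).right_inv hzt]
    · rintro ⟨y, hy, rfl⟩
      refine ⟨?_, transition_mem (hSo hy)⟩
      rw [Set.mem_preimage, symm_transition (hSo hy)]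
      exact hy.1
  have hinj : Set.InjOn (transition p q) S := by
    intro y hy z hz hyz
    have := congrArg (extChartAt (𝓡 2) p).symm hyz
    rw [symm_transition (hSo hy), symm_transition (hSo hz)] at this
    have := congrArg (extChartAt (𝓡 2) q) this
    rwa [(extChartAt (𝓡 2) q).right_inv hy.2, (extChartAt (𝓡 2) q).right_inv hz.2] at this
  have hSm : MeasurableSet S := measurableSet_preimage_inter_target q hA
  rw [himg, lintegral_image_eq_lintegral_abs_det_fderiv_mul volume hSm
    (fun y hy => (differentiableAt_transition (hSo hy)).hasFDerivAt.hasFDerivWithinAt) hinj]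
  refine setLIntegral_congr_fun hSm fun y hy => ?_
  have hi := isIsometryOn_transition g p q
  have hd := differentiableAt_transition (hSo hy)
  simp only [hi.det_eq (hSo hy), det_eq_of_fin_two, pd_comp_apply hd]
  rw [← ENNReal.ofReal_mul (abs_nonneg _), Real.sqrt_mul (sq_nonneg _), Real.sqrt_sq_eq_abs]

theorem chartVolume_le_of_subset (hA : MeasurableSet A)
    (hp : A ⊆ (extChartAt (𝓡 2) p).source) : chartVolume g q A ≤ chartVolume g p A := by
  rw [← chartVolume_inter_source g q hA,
    ← chartVolume_eq g (p := p) (hA.inter (isOpen_extChartAt_source q).measurableSet)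
      (Set.inter_subset_left.trans hp) Set.inter_subset_right]
  exact measure_mono Set.inter_subset_left

/-- The Riemannian volume restricts to the volume of a chart. -/
theorem vol_restrict_source (p : M) :
    (vol g).restrict (extChartAt (𝓡 2) p).source = chartVolume g p := by
  have hs : MeasurableSet (extChartAt (𝓡 2) p).source := (isOpen_extChartAt_source p).measurableSet
  -- an upper bound of all chart volumes that agrees with the volume of the chart around `p` on the
  -- domain of that chart
  have hle : vol g ≤ chartVolume g p + (vol g).restrict (extChartAt (𝓡 2) p).sourceᶜ := by
    refine iSup_le fun q => Measure.le_iff.2 fun s hm => ?_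
    rw [← measure_inter_add_sdiff s hs, Measure.add_apply, Measure.restrict_apply hm]
    refine add_le_add ?_ (le_iSup (chartVolume g) q _)
    exact (chartVolume_le_of_subset g (hm.inter hs) Set.inter_subset_right).trans
      (measure_mono Set.inter_subset_left)
  refine le_antisymm (Measure.le_iff.2 fun s hm => ?_) (Measure.le_iff.2 fun s hm => ?_)
  · rw [Measure.restrict_apply hm]
    refine (hle _).trans ?_
    rw [Measure.add_apply, Measure.restrict_apply (hm.inter hs), Set.inter_assoc,
      Set.inter_compl_self, Set.inter_empty, measure_empty, add_zero]
    exact measure_mono Set.inter_subset_left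
  · rw [Measure.restrict_apply hm, ← chartVolume_inter_source g p hm]
    exact le_iSup (chartVolume g) p _

/-- Integration in a chart of a function supported there. -/
theorem integral_vol_eq (p : M) {f : M → ℝ} {F : E2 → ℝ}
    (hf : ∀ m ∉ (extChartAt (𝓡 2) p).source, f m = 0)
    (hF : ContinuousOn F (extChartAt (𝓡 2) p).target)
    (hF0 : ∀ y ∉ (extChartAt (𝓡 2) p).target, F y = 0)
    (hfF : ∀ m ∈ (extChartAt (𝓡 2) p).source, f m = F (extChartAt (𝓡 2) p m)) :
    ∫ m, f m ∂(vol g) = ∫ y, F y * Real.sqrt (gram g p y).det := by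
  have hT := (isOpen_extChartAt_target (I := 𝓡 2) p).measurableSet
  have hs : MeasurableSet (extChartAt (𝓡 2) p).source := (isOpen_extChartAt_source p).measurableSet
  have hfc : ContinuousOn f (extChartAt (𝓡 2) p).source :=
    (hF.comp (continuousOn_extChartAt p) fun m hm => (extChartAt (𝓡 2) p).map_source hm).congr hfF
  have hfm : AEStronglyMeasurable f (chartVolume g p) := by
    rw [← vol_restrict_source]; exact hfc.aestronglyMeasurable hs
  have hρ : AEMeasurable (fun y => ENNReal.ofReal (Real.sqrt (gram g p y).det))
      ((volume : Measure E2).restrict (extChartAt (𝓡 2) p).target) :=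
    ((isMetricOn_gram g p).contDiffOn_sqrt_det.continuousOn.aemeasurable hT).ennreal_ofReal
  rw [← setIntegral_eq_integral_of_forall_compl_eq_zero hf, vol_restrict_source]
  rw [chartVolume] at hfm ⊢
  rw [integral_map ((aemeasurable_extChartAt_symm p).mono_ac
    (withDensity_absolutelyContinuous _ _)) hfm,
    integral_withDensity_eq_integral_toReal_smul₀ hρ (.of_forall fun _ => ENNReal.ofReal_lt_top)]
  refine Eq.trans ?_ (setIntegral_eq_integral_of_forall_compl_eq_zero
    (s := (extChartAt (𝓡 2) p).target) fun y hy => by rw [hF0 y hy, zero_mul])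
  refine setIntegral_congr_fun hT fun y hy => ?_
  simp only [ENNReal.toReal_ofReal (Real.sqrt_nonneg _), smul_eq_mul,
    hfF _ ((extChartAt (𝓡 2) p).map_target hy), (extChartAt (𝓡 2) p).right_inv hy]
  ring

end

/-! ### Functions supported in a chart and their gradients -/

section

variable {M : Type*} [TopologicalSpace M] [ChartedSpace E2 M] {p m : M} {a : E2 → ℝ}

open scoped Classical in
/-- The function on the surface that is `a` in the coordinates of the chart around `p` and is zero
outside of the domain of that chart. -/
def extend (p : M) (a : E2 → ℝ) (m : M) : ℝ :=
  if m ∈ (extChartAt (𝓡 2) p).source then a (extChartAt (𝓡 2) p m) else 0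

theorem eventually_extChartAt_notMem_tsupport [T2Space M]
    (ha : IsTest ∞ (extChartAt (𝓡 2) p).target a) (hm : m ∉ (extChartAt (𝓡 2) p).source) :
    ∀ᶠ z in 𝓝 m, z ∈ (extChartAt (𝓡 2) p).source →
      extChartAt (𝓡 2) p z ∉ tsupport a := by
  have hK : IsCompact ((extChartAt (𝓡 2) p).symm '' tsupport a) :=
    ha.compact.isCompact.image_of_continuousOn
      ((continuousOn_extChartAt_symm p).mono ha.tsupport_subset)
  have hmK : m ∉ (extChartAt (𝓡 2) p).symm '' tsupport a := by
    rintro ⟨y, hy, rfl⟩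
    exact hm ((extChartAt (𝓡 2) p).map_target (ha.tsupport_subset hy))
  filter_upwards [hK.isClosed.isOpen_compl.mem_nhds hmK] with z hz hzs hzt
  exact hz ⟨_, hzt, (extChartAt (𝓡 2) p).left_inv hzs⟩

theorem extend_eventuallyEq_zero [T2Space M]
    (ha : IsTest ∞ (extChartAt (𝓡 2) p).target a) (hm : m ∉ (extChartAt (𝓡 2) p).source) :
    extend p a =ᶠ[𝓝 m] fun _ => 0 := by
  filter_upwards [eventually_extChartAt_notMem_tsupport ha hm] with z hz
  unfold extend
  split_ifs with h
  · exact image_eq_zero_of_notMem_tsupport (hz h)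
  · rfl

theorem extend_eventuallyEq (a : E2 → ℝ) (hm : m ∈ (extChartAt (𝓡 2) p).source) :
    extend p a =ᶠ[𝓝 m] a ∘ extChartAt (𝓡 2) p := by
  filter_upwards [(isOpen_extChartAt_source p).mem_nhds hm] with z hz
  rw [extend, if_pos hz]; rfl

theorem mfderiv_extend_of_notMem [T2Space M] (ha : IsTest ∞ (extChartAt (𝓡 2) p).target a)
    (hm : m ∉ (extChartAt (𝓡 2) p).source) (v : TangentSpace (𝓡 2) m) :
    (show ℝ from mfderiv (𝓡 2) 𝓘(ℝ, ℝ) (extend p a) m v) = 0 := by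
  have h := ((extend_eventuallyEq_zero ha hm).mfderiv_eq (I := 𝓡 2) (I' := 𝓘(ℝ, ℝ))).trans
    mfderiv_const
  exact congrArg (fun L : TangentSpace (𝓡 2) m →L[ℝ] ℝ => L v) h

variable [IsManifold (𝓡 2) ∞ M]

theorem contMDiff_extend [T2Space M] (ha : IsTest ∞ (extChartAt (𝓡 2) p).target a) :
    ContMDiff (𝓡 2) 𝓘(ℝ, ℝ) ∞ (extend p a) := by
  intro m
  by_cases hm : m ∈ (extChartAt (𝓡 2) p).source
  · refine ContMDiffAt.congr_of_eventuallyEq ?_ (extend_eventuallyEq a hm)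
    refine ha.contDiff.contMDiff.contMDiffAt.comp m (contMDiffAt_extChartAt' ?_)
    rwa [← extChartAt_source (𝓡 2)]
  · exact contMDiffAt_const.congr_of_eventuallyEq (extend_eventuallyEq_zero ha hm)

theorem mfderiv_extend (ha : IsTest ∞ (extChartAt (𝓡 2) p).target a)
    (hm : m ∈ (extChartAt (𝓡 2) p).source) (v : TangentSpace (𝓡 2) m) :
    (show ℝ from mfderiv (𝓡 2) 𝓘(ℝ, ℝ) (extend p a) m v)
      = pd 0 a (extChartAt (𝓡 2) p m) * chartD p m v 0
        + pd 1 a (extChartAt (𝓡 2) p m) * chartD p m v 1 := by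
  have hd := (ha.of_le (by simp : (1 : ℕ∞ω) ≤ ∞)).differentiableAt (extChartAt (𝓡 2) p m)
  have h := mfderiv_comp m hd.mdifferentiableAt (mdifferentiableAt_chart hm)
  rw [mfderiv_eq_fderiv] at h
  have h2 := ((extend_eventuallyEq a hm).mfderiv_eq (I := 𝓡 2) (I' := 𝓘(ℝ, ℝ))).trans h
  have h3 : (show ℝ from mfderiv (𝓡 2) 𝓘(ℝ, ℝ) (extend p a) m v)
      = fderiv ℝ a (extChartAt (𝓡 2) p m) (chartD p m v) :=
    congrArg (fun L : TangentSpace (𝓡 2) m →L[ℝ] ℝ => L v) h2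
  rw [h3, fderiv_apply_eq_pd]
  ring

variable (g : Metric M)

open scoped Classical in
/-- The gradient of `extend p a`, written in the coordinates of the chart around `p`. -/
def gradExtend (p : M) (a : E2 → ℝ) (m : M) : TangentSpace (𝓡 2) m :=
  if m ∈ (extChartAt (𝓡 2) p).source then
    ∑ i, (∑ j, (gram g p (extChartAt (𝓡 2) p m))⁻¹ i j * pd j a (extChartAt (𝓡 2) p m))
      • frame p m i
  else 0

theorem chartD_gradExtend (a : E2 → ℝ) (hm : m ∈ (extChartAt (𝓡 2) p).source) (i : Fin 2) :
    chartD p m (gradExtend g p a m) i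
      = ∑ j, (gram g p (extChartAt (𝓡 2) p m))⁻¹ i j * pd j a (extChartAt (𝓡 2) p m) := by
  rw [gradExtend, if_pos hm, Fin.sum_univ_two, map_add, map_smul, map_smul, chartD_frame hm,
    chartD_frame hm]
  fin_cases i <;> simp

theorem inner_gradExtend [T2Space M] (ha : IsTest ∞ (extChartAt (𝓡 2) p).target a)
    (v : TangentSpace (𝓡 2) m) :
    g.inner m (gradExtend g p a m) v
      = (show ℝ from mfderiv (𝓡 2) 𝓘(ℝ, ℝ) (extend p a) m v) := by
  by_cases hm : m ∈ (extChartAt (𝓡 2) p).source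
  · rw [mfderiv_extend ha hm, inner_eq_gram g hm]
    simp only [chartD_gradExtend g a hm, Fin.sum_univ_two]
    have hG := isMetricOn_gram g p
    have hy := (extChartAt (𝓡 2) p).map_source hm
    have h := hG.sum_mul_inv hy
    have h00 := h 0 0
    have h01 := h 0 1
    have h10 := h 1 0
    have h11 := h 1 1
    have hs := hG.symm _ hy 1 0
    simp only [hs, if_true, zero_ne_one, one_ne_zero, if_false] at h00 h01 h10 h11 ⊢
    set y := extChartAt (𝓡 2) p m
    linear_combination (pd 0 a y * chartD p m v 0) * h00 + (pd 1 a y * chartD p m v 0) * h01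
      + (pd 0 a y * chartD p m v 1) * h10 + (pd 1 a y * chartD p m v 1) * h11
  · rw [mfderiv_extend_of_notMem ha hm, gradExtend, if_neg hm, map_zero]
    rfl

theorem isField_gradExtend [T2Space M] (ha : IsTest ∞ (extChartAt (𝓡 2) p).target a) :
    IsField ∞ (gradExtend g p a) := by
  intro m
  by_cases hm : m ∈ (extChartAt (𝓡 2) p).source
  · refine ContMDiffOn.contMDiffAt ?_ ((isOpen_extChartAt_source p).mem_nhds hm)
    rw [contMDiffOn_field_iff le_rfl]
    have hG := isMetricOn_gram g p
    have h1 : ContDiffOn ℝ ∞ (fun y => WithLp.toLp 2 fun i => ∑ j, (gram g p y)⁻¹ i j * pd j a y)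
        (extChartAt (𝓡 2) p).target := by
      rw [contDiffOn_piLp]
      intro i
      exact ContDiffOn.sum (s := Finset.univ) fun j _ =>
        (hG.contDiffOn_inv i j).mul (ha.isTest_pd (k := ∞) (by simp) j).contDiff.contDiffOn
    have h2 : ContMDiffOn (𝓡 2) 𝓘(ℝ, E2) ∞ (extChartAt (𝓡 2) p) (extChartAt (𝓡 2) p).source := by
      have := contMDiffOn_extChartAt (I := 𝓡 2) (n := ∞) (x := p)
      rwa [← extChartAt_source (𝓡 2)] at this
    refine (h1.contMDiffOn.comp h2 fun z hz => (extChartAt (𝓡 2) p).map_source hz).congr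
      fun z hz => ?_
    ext i
    exact chartD_gradExtend g a hz i
  · refine ((Bundle.contMDiff_zeroSection ℝ (TangentSpace (𝓡 2) : M → Type _)).contMDiffAt
      (x := m)).congr_of_eventuallyEq ?_
    filter_upwards [eventually_extChartAt_notMem_tsupport ha hm] with z hz
    have : gradExtend g p a z = 0 := by
      unfold gradExtend
      split_ifs with h
      · refine Finset.sum_eq_zero fun i _ => ?_
        rw [Finset.sum_eq_zero, zero_smul]
        intro j _
        rw [pd_eq_zero_of_notMem_tsupport j (hz h), mul_zero]
      · rfl
    rw [this]; rfl

variable [T2Space M] [MeasurableSpace M] [BorelSpace M]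

/-- The pairing of a vector field with the differential of a function supported in a chart. -/
theorem integral_mfderiv_extend (ha : IsTest ∞ (extChartAt (𝓡 2) p).target a)
    {W : ∀ x : M, TangentSpace (𝓡 2) x}
    (hW : ∀ i, ContinuousOn (comp W p i) (extChartAt (𝓡 2) p).target) :
    ∫ x, (show ℝ from mfderiv (𝓡 2) 𝓘(ℝ, ℝ) (extend p a) x (W x)) ∂(vol g)
      = ∫ y, (pd 0 a y * comp W p 0 y + pd 1 a y * comp W p 1 y)
        * Real.sqrt (gram g p y).det := by
  refine integral_vol_eq g p (fun m hm => mfderiv_extend_of_notMem ha hm _) ?_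
    (fun y hy => by rw [ha.pd_eq_zero hy, ha.pd_eq_zero hy]; ring) fun m hm => ?_
  · have hp : ∀ i, Continuous (pd i a) := fun i =>
      (ha.isTest_pd (k := 0) (by simp) i).contDiff.continuous
    exact ((hp 0).continuousOn.mul (hW 0)).add ((hp 1).continuousOn.mul (hW 1))
  · rw [mfderiv_extend ha hm, comp_extChartAt W hm, comp_extChartAt W hm]

end

/-! ### Monge-Ampère equation, divergence-free fields, asymptotic vectors -/

section

/-- The square of the length of a covector, by the explicit inverse of a `2 × 2` matrix. -/
theorem sum_inv_mul_mul (A : Matrix (Fin 2) (Fin 2) ℝ) (w : Fin 2 → ℝ) :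
    ∑ i, ∑ j, A⁻¹ i j * w i * w j
      = (A 1 1 * w 0 ^ 2 - (A 0 1 + A 1 0) * w 0 * w 1 + A 0 0 * w 1 ^ 2) / A.det := by
  simp only [Fin.sum_univ_two, Matrix.inv_def, Matrix.adjugate_fin_two, Ring.inverse_eq_inv',
    Matrix.smul_apply, smul_eq_mul, Matrix.of_apply, Matrix.cons_val', Matrix.cons_val_zero,
    Matrix.cons_val_one, Matrix.cons_val_fin_one]
  ring

/-- The length of a covector is invariant under isometries. -/
theorem IsIsometryOn.sum_inv_mul_mul {τ : E2 → E2} {G G' : E2 → Matrix (Fin 2) (Fin 2) ℝ}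
    {U V : Set E2} {y : E2} (h : IsIsometryOn τ G G' U V) (hy : y ∈ V) {w w' : Fin 2 → ℝ}
    (hw : ∀ k, w' k = w 0 * pd k (fun z => τ z 0) y + w 1 * pd k (fun z => τ z 1) y) :
    ∑ i, ∑ j, (G' y)⁻¹ i j * w' i * w' j = ∑ i, ∑ j, (G (τ y))⁻¹ i j * w i * w j := by
  have h1 := h.jacobian_ne_zero hy
  have h2 := (h.target.det_pos _ (h.mapsTo y hy)).ne'
  rw [SurfaceFlow.sum_inv_mul_mul, SurfaceFlow.sum_inv_mul_mul, h.det_eq hy,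
    div_eq_div_iff (mul_ne_zero (pow_ne_zero 2 h1) h2) h2]
  simp only [hw, h.pullback y hy, Fin.sum_univ_two]
  ring

/-- At a local maximum of `|∇f|²`, the gradient of `f` is in the kernel of its Hessian. -/
theorem IsMetricOn.hessian_mul_grad_eq_zero {G : E2 → Matrix (Fin 2) (Fin 2) ℝ} {U : Set E2}
    {y : E2} (hG : IsMetricOn G U) (hy : y ∈ U) {f : E2 → ℝ} (hf : ContDiffOn ℝ 2 f U)
    (hmax : IsLocalMax (fun z => ∑ i, ∑ j, (G z)⁻¹ i j * pd i f z * pd j f z) y) (k : Fin 2) :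
    ∑ j, (pd k (pd j f) y - ∑ m, chr G m k j y * pd m f y) * (∑ l, (G y)⁻¹ j l * pd l f y) = 0 := by
  have hf1 : ∀ i, ContDiffOn ℝ 1 (pd i f) U := fun i =>
    contDiffOn_pd i hG.isOpen hf (by norm_num)
  set u : Fin 2 → E2 → ℝ := fun i z => ∑ l, (G z)⁻¹ i l * pd l f z with hu
  have hu1 : ∀ i, ContDiffOn ℝ 1 (u i) U := fun i =>
    ContDiffOn.sum (s := Finset.univ) fun l _ =>
      ((hG.contDiffOn_inv i l).of_le (by simp)).mul (hf1 l)
  have df : ∀ i, DifferentiableAt ℝ (pd i f) y := fun i =>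
    differentiableAt_of_contDiffOn hG.isOpen (hf1 i) one_ne_zero hy
  have du : ∀ i, DifferentiableAt ℝ (u i) y := fun i =>
    differentiableAt_of_contDiffOn hG.isOpen (hu1 i) one_ne_zero hy
  have dG := hG.differentiableAt hy
  have hlow : ∀ z ∈ U, ∀ j, pd j f z = G z j 0 * u 0 z + G z j 1 * u 1 z := by
    intro z hz j
    have h0 := hG.sum_mul_inv hz j 0
    have h1 := hG.sum_mul_inv hz j 1
    simp only [hu, Fin.sum_univ_two]
    fin_cases j <;> simp only [Fin.zero_eta, Fin.mk_one, Fin.isValue, if_true, zero_ne_one,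
      one_ne_zero, if_false] at h0 h1 ⊢ <;> linear_combination - pd 0 f z * h0 - pd 1 f z * h1
  have e1 : ∀ j, pd k (pd j f) y = (pd k (fun z => G z j 0) y * u 0 y + G y j 0 * pd k (u 0) y)
      + (pd k (fun z => G z j 1) y * u 1 y + G y j 1 * pd k (u 1) y) := by
    intro j
    rw [← pd_mul k (dG _ _) (du _), ← pd_mul k (dG _ _) (du _),
      ← pd_add k ((dG _ _).fun_mul (du _)) ((dG _ _).fun_mul (du _))]
    refine pd_congr k ?_
    filter_upwards [hG.isOpen.mem_nhds hy] with z hz using hlow z hz j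
  have e2 : (pd k (pd 0 f) y * u 0 y + pd 0 f y * pd k (u 0) y)
      + (pd k (pd 1 f) y * u 1 y + pd 1 f y * pd k (u 1) y) = 0 := by
    rw [← pd_mul k (df _) (du _), ← pd_mul k (df _) (du _),
      ← pd_add k ((df _).fun_mul (du _)) ((df _).fun_mul (du _))]
    have : (fun z => ∑ i, ∑ j, (G z)⁻¹ i j * pd i f z * pd j f z)
        = fun z => pd 0 f z * u 0 z + pd 1 f z * u 1 z := by
      funext z; simp only [hu, Fin.sum_univ_two]; ring
    rw [this] at hmax
    exact congrArg (fun L : E2 →L[ℝ] ℝ => L (EuclideanSpace.single k 1)) hmax.fderiv_eq_zero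
  have e10 := e1 0
  have e11 := e1 1
  have hs : G y 1 0 = G y 0 1 := hG.symm y hy 1 0
  change ∑ j, (pd k (pd j f) y - ∑ m, chr G m k j y * pd m f y) * u j y = 0
  simp only [hG.pd_eq hy, hs] at e10 e11
  simp only [Fin.sum_univ_two, hlow y hy, hs] at e2 ⊢
  linear_combination (1 / 2) * e2 + (1 / 2) * u 0 y * e10 + (1 / 2) * u 1 y * e11

variable {M : Type*} [TopologicalSpace M] [ChartedSpace E2 M] [IsManifold (𝓡 2) ∞ M]
  {g : Metric M} {p q m : M} {ψ : M → ℝ}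

theorem contDiffOn_comp_symm (hψ : ContMDiff (𝓡 2) 𝓘(ℝ, ℝ) 2 ψ) (p : M) :
    ContDiffOn ℝ 2 (fun z => ψ ((extChartAt (𝓡 2) p).symm z)) (extChartAt (𝓡 2) p).target :=
  (hψ.comp_contMDiffOn ((contMDiffOn_extChartAt_symm (n := ∞) p).of_le
    (WithTop.coe_le_coe.2 le_top))).contDiffOn

/-- The length of the gradient may be computed in any chart. -/
theorem gradNormSq_eq (hψ : ContMDiff (𝓡 2) 𝓘(ℝ, ℝ) 2 ψ)
    (hp : m ∈ (extChartAt (𝓡 2) p).source) (hq : m ∈ (extChartAt (𝓡 2) q).source) :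
    gradNormSq g ψ q (extChartAt (𝓡 2) q m) = gradNormSq g ψ p (extChartAt (𝓡 2) p m) := by
  have hy := mem_overlap hp hq
  have h := (isIsometryOn_transition g p q).sum_inv_mul_mul hy
    (w := fun k => pd k (fun z => ψ ((extChartAt (𝓡 2) p).symm z))
      (transition p q (extChartAt (𝓡 2) q m)))
    (w' := fun k => pd k (fun z => ψ ((extChartAt (𝓡 2) q).symm z)) (extChartAt (𝓡 2) q m)) ?_
  · rw [transition_extChartAt hq] at h
    exact h
  · intro k
    have hd := differentiableAt_of_contDiffOn (isOpen_extChartAt_target p)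
      (contDiffOn_comp_symm hψ p) two_ne_zero (transition_mem hy)
    rw [← pd_comp k hd (differentiableAt_transition hy)]
    refine pd_congr k ?_
    filter_upwards [(isOpen_overlap p q).mem_nhds hy] with z hz
    rw [symm_transition hz]

/-- The coordinate expression of `|∇ψ|²` is `g(v, v)` for the vector `v = ∇ψ`, which is not zero
where a partial derivative of `ψ` is not. -/
theorem gradNormSq_pos (g : Metric M) (ψ : M → ℝ) {y : E2} (hy : y ∈ (extChartAt (𝓡 2) p).target)
    (h : ∃ i, pd i (fun z => ψ ((extChartAt (𝓡 2) p).symm z)) y ≠ 0) :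
    0 < gradNormSq g ψ p y := by
  have hG := isMetricOn_gram g p
  have hm := (extChartAt (𝓡 2) p).map_target hy
  set w : Fin 2 → ℝ := fun i => pd i (fun z => ψ ((extChartAt (𝓡 2) p).symm z)) y with hw
  set u : Fin 2 → ℝ := fun i => (gram g p y)⁻¹ i 0 * w 0 + (gram g p y)⁻¹ i 1 * w 1 with hu
  set v : TangentSpace (𝓡 2) ((extChartAt (𝓡 2) p).symm y) :=
    u 0 • frame p _ 0 + u 1 • frame p _ 1 with hv
  have hvu : ∀ i, chartD p _ v i = u i := by
    intro i
    rw [hv, map_add, map_smul, map_smul, chartD_frame hm, chartD_frame hm]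
    fin_cases i <;> simp
  have hGu : ∀ j, gram g p y j 0 * u 0 + gram g p y j 1 * u 1 = w j := by
    intro j
    have h0 := hG.sum_mul_inv hy j 0
    have h1 := hG.sum_mul_inv hy j 1
    simp only [hu]
    fin_cases j <;> simp only [Fin.zero_eta, Fin.mk_one, Fin.isValue, if_true, zero_ne_one,
      one_ne_zero, if_false] at h0 h1 ⊢ <;> linear_combination w 0 * h0 + w 1 * h1
  have hv0 : v ≠ 0 := by
    intro h0
    obtain ⟨i, hi⟩ := h
    refine hi ?_
    change w i = 0
    have : ∀ i, u i = 0 := fun i => by rw [← hvu, h0, map_zero]; rfl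
    rw [← hGu, this, this]; ring
  have := g.pos _ v hv0
  rw [inner_eq_gram g hm, (extChartAt (𝓡 2) p).right_inv hy] at this
  have e : gradNormSq g ψ p y = w 0 * u 0 + w 1 * u 1 := by
    simp only [gradNormSq, Fin.sum_univ_two, hu, hw]; ring
  have hG0 := hGu 0
  have hG1 := hGu 1
  simp only [hvu, Fin.sum_univ_two] at this
  rw [e, ← hG0, ← hG1]
  linarith

/-- The length of the gradient of a solution of the Monge-Ampère equation is zero where it is
maximal, because the Hessian degenerates there. -/
theorem gradNormSq_eq_zero_of_isMaxOn (hK : ∀ x : M, gaussCurvature g x ≠ 0)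
    (hψ : ContMDiff (𝓡 2) 𝓘(ℝ, ℝ) 2 ψ) (h : SolvesMongeAmpere g ψ) {x : M}
    (hx : IsMaxOn (fun q => gradNormSq g ψ q (extChartAt (𝓡 2) q q)) Set.univ x) :
    gradNormSq g ψ x (extChartAt (𝓡 2) x x) = 0 := by
  have hG := isMetricOn_gram g x
  have hxs := mem_extChartAt_source (I := 𝓡 2) x
  set y := extChartAt (𝓡 2) x x with hyd
  have hy : y ∈ (extChartAt (𝓡 2) x).target := mem_extChartAt_target x
  set f : E2 → ℝ := fun z => ψ ((extChartAt (𝓡 2) x).symm z) with hfd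
  have hmax : IsLocalMax (gradNormSq g ψ x) y := by
    filter_upwards [(isOpen_extChartAt_target x).mem_nhds hy] with z hz
    have h1 := gradNormSq_eq (g := g) hψ (mem_extChartAt_source (I := 𝓡 2)
      ((extChartAt (𝓡 2) x).symm z)) ((extChartAt (𝓡 2) x).map_target hz)
    rw [(extChartAt (𝓡 2) x).right_inv hz] at h1
    rw [h1]
    exact hx (Set.mem_univ _)
  have hk := hG.hessian_mul_grad_eq_zero hy (contDiffOn_comp_symm hψ x) hmax
  have hMA := h x
  set u : Fin 2 → ℝ := fun j => ∑ l, (gram g x y)⁻¹ j l * pd l f y with hu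
  have hH : ∀ k, hessian g ψ x y k 0 * u 0 + hessian g ψ x y k 1 * u 1 = 0 := by
    intro k
    have := hk k
    rw [Fin.sum_univ_two] at this
    exact this
  have hF : gradNormSq g ψ x y = pd 0 f y * u 0 + pd 1 f y * u 1 := by
    simp only [gradNormSq, Fin.sum_univ_two, hu, hfd]; ring
  by_cases hd : (hessian g ψ x y).det = 0
  · rw [hd] at hMA
    have h1 : (gram g x y).det * gaussCurvature g x / 2 ≠ 0 :=
      div_ne_zero (mul_ne_zero (hG.det_pos y hy).ne' (hK x)) two_ne_zero
    exact (mul_eq_zero.1 hMA.symm).resolve_left h1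
  · rw [Matrix.det_fin_two] at hd
    have h0 := hH 0
    have h1 := hH 1
    have u0 : u 0 = 0 := by
      refine mul_left_cancel₀ hd ?_
      linear_combination hessian g ψ x y 1 1 * h0 - hessian g ψ x y 0 1 * h1
    have u1 : u 1 = 0 := by
      refine mul_left_cancel₀ hd ?_
      linear_combination hessian g ψ x y 0 0 * h1 - hessian g ψ x y 1 0 * h0
    rw [hF, u0, u1]; ring

/-- The maximum of `|∇ψ|²` is zero, so the differential of `ψ` vanishes in every chart. -/
theorem isLocallyConstant_of_solvesMongeAmpere [CompactSpace M]
    (hK : ∀ x : M, gaussCurvature g x ≠ 0) (hψ : ContMDiff (𝓡 2) 𝓘(ℝ, ℝ) 2 ψ)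
    (h : SolvesMongeAmpere g ψ) : IsLocallyConstant ψ := by
  have hcont : Continuous fun q => gradNormSq g ψ q (extChartAt (𝓡 2) q q) := by
    refine continuous_iff_continuousAt.2 fun p => ?_
    have hp := mem_extChartAt_source (I := 𝓡 2) p
    have h1 : ContinuousAt (fun q => gradNormSq g ψ p (extChartAt (𝓡 2) p q)) p := by
      have hy := (isOpen_extChartAt_target p).mem_nhds (mem_extChartAt_target (I := 𝓡 2) p)
      have hd : ∀ i, ContinuousAt (pd i fun z => ψ ((extChartAt (𝓡 2) p).symm z))
          (extChartAt (𝓡 2) p p) := fun i =>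
        (contDiffOn_pd (m := 1) i (isOpen_extChartAt_target p) (contDiffOn_comp_symm hψ p)
          (by norm_num)).continuousOn.continuousAt hy
      have hi : ∀ i j, ContinuousAt (fun z => (gram g p z)⁻¹ i j) (extChartAt (𝓡 2) p p) :=
        fun i j => ((isMetricOn_gram g p).contDiffOn_inv i j).continuousOn.continuousAt hy
      have h2 : ContinuousAt (gradNormSq g ψ p) (extChartAt (𝓡 2) p p) := by
        unfold gradNormSq
        exact tendsto_finsetSum _ fun i _ => tendsto_finsetSum _ fun j _ =>
          ((hi i j).mul (hd i)).mul (hd j)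
      exact h2.comp (continuousAt_extChartAt p)
    refine h1.congr ?_
    filter_upwards [(isOpen_extChartAt_source p).mem_nhds hp] with q hq
    exact gradNormSq_eq hψ (mem_extChartAt_source (I := 𝓡 2) q) hq
  have hle : ∀ q, gradNormSq g ψ q (extChartAt (𝓡 2) q q) ≤ 0 := by
    intro q
    have : Nonempty M := ⟨q⟩
    obtain ⟨x, -, hx⟩ := isCompact_univ.exists_isMaxOn Set.univ_nonempty hcont.continuousOn
    rw [← gradNormSq_eq_zero_of_isMaxOn hK hψ h hx]
    exact hx (Set.mem_univ q)
  refine (IsLocallyConstant.iff_eventually_eq ψ).2 fun p => ?_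
  have hz : ∀ y ∈ (extChartAt (𝓡 2) p).target,
      fderiv ℝ (fun z => ψ ((extChartAt (𝓡 2) p).symm z)) y = 0 := by
    intro y hy
    have hi : ∀ i, pd i (fun z => ψ ((extChartAt (𝓡 2) p).symm z)) y = 0 := by
      by_contra! hne
      have h1 := gradNormSq_pos g ψ hy hne
      have h2 := gradNormSq_eq (g := g) hψ (mem_extChartAt_source (I := 𝓡 2)
        ((extChartAt (𝓡 2) p).symm y)) ((extChartAt (𝓡 2) p).map_target hy)
      rw [(extChartAt (𝓡 2) p).right_inv hy] at h2
      rw [h2] at h1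
      exact absurd h1 (hle _).not_gt
    ext v
    rw [fderiv_apply_eq_pd, hi, hi]; simp
  obtain ⟨r, hr, hball⟩ := Metric.isOpen_iff.1 (isOpen_extChartAt_target p) _
    (mem_extChartAt_target (I := 𝓡 2) p)
  have hconst : ∀ y ∈ Metric.ball (extChartAt (𝓡 2) p p) r,
      ψ ((extChartAt (𝓡 2) p).symm y) = ψ p := by
    intro y hy
    have := Metric.isOpen_ball.is_const_of_fderiv_eq_zero (𝕜 := ℝ)
      (convex_ball (extChartAt (𝓡 2) p p) r).isPreconnected
      (((contDiffOn_comp_symm hψ p).mono hball).differentiableOn two_ne_zero)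
      (fun z hz' => hz z (hball hz')) hy (Metric.mem_ball_self hr)
    simpa using this
  have hnhds := (continuousAt_extChartAt (I := 𝓡 2) p).preimage_mem_nhds (Metric.ball_mem_nhds _ hr)
  filter_upwards [hnhds, (isOpen_extChartAt_source (I := 𝓡 2) p).mem_nhds
    (mem_extChartAt_source p)] with q hq hqs
  rw [← hconst _ hq, (extChartAt (𝓡 2) p).left_inv hqs]

/-- The common core of the statements on vector fields: the identity `tr (∇X)² + K |X|² = 0` makes
`∇X` nondegenerate wherever `X` is not zero. -/
theorem eq_zero_of_integral_eq_zero [CompactSpace M] (hK : ∀ x : M, gaussCurvature g x ≠ 0)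
    {X : ∀ x : M, TangentSpace (𝓡 2) x} (hX : IsField 1 X) (hdiv : ∀ x, divergence g X x = 0)
    (hweak : ∀ (p : M) (a : E2 → ℝ), IsTest ∞ (extChartAt (𝓡 2) p).target a →
      ∫ y, (pd 0 a y * comp (covDeriv g X X) p 0 y + pd 1 a y * comp (covDeriv g X X) p 1 y)
        * Real.sqrt (gram g p y).det = 0) (x : M) : X x = 0 := by
  have hc : ∀ q i, ContDiffOn ℝ 1 (comp X q i) (extChartAt (𝓡 2) q).target :=
    fun q i => contDiffOn_comp hX q i (by simp)
  refine eq_zero_of_det_eq_zero g hX (fun x hdet => ?_) x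
  have hx := mem_extChartAt_source (I := 𝓡 2) x
  have hy : extChartAt (𝓡 2) x x ∈ (extChartAt (𝓡 2) x).target := mem_extChartAt_target x
  have hdiv' : ∀ y ∈ (extChartAt (𝓡 2) x).target,
      covM (gram g x) (comp X x) 0 0 y + covM (gram g x) (comp X x) 1 1 y = 0 := by
    intro y hy
    have := divergence_eq g hc ((extChartAt (𝓡 2) x).map_target hy)
    rw [hdiv, (extChartAt (𝓡 2) x).right_inv hy] at this
    exact this.symm
  have h := (isMetricOn_gram g x).trace_sq_add_curvature (hc x) hdiv' (fun a ha => by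
    rw [← hweak x a ha]
    congr 1
    funext y
    by_cases hy : y ∈ (extChartAt (𝓡 2) x).target
    · rw [comp_covDeriv g X hc hy, comp_covDeriv g X hc hy]
    · rw [ha.pd_eq_zero hy, ha.pd_eq_zero hy, zero_mul, zero_mul, zero_mul, zero_mul]) hy
  have ht := hdiv' _ hy
  rw [Matrix.det_fin_two] at hdet
  change covM (gram g x) (comp X x) 0 0 _ * covM (gram g x) (comp X x) 1 1 _
    - covM (gram g x) (comp X x) 0 1 _ * covM (gram g x) (comp X x) 1 0 _ = 0 at hdet
  change _ + gaussCurvature g x * _ = 0 at h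
  simp only [comp_extChartAt X hx] at h
  rw [← inner_eq_gram g hx] at h
  have h0 : gaussCurvature g x * g.inner x (X x) (X x) = 0 := by
    linear_combination h - (covM (gram g x) (comp X x) 0 0 (extChartAt (𝓡 2) x x)
      + covM (gram g x) (comp X x) 1 1 (extChartAt (𝓡 2) x x)) * ht + 2 * hdet
  by_contra hne
  exact (g.pos x (X x) hne).ne' ((mul_eq_zero.1 h0).resolve_left (hK x))

/-- A divergence-free field is divergence-free in the weak sense, tested in a chart. -/
theorem integral_pd_mul_comp_eq_zero {W : ∀ x : M, TangentSpace (𝓡 2) x}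
    (hW : ∀ q i, ContDiffOn ℝ 1 (comp W q i) (extChartAt (𝓡 2) q).target)
    (hdiv : ∀ x, divergence g W x = 0) (p : M) {a : E2 → ℝ}
    (ha : IsTest ∞ (extChartAt (𝓡 2) p).target a) :
    ∫ y, (pd 0 a y * comp W p 0 y + pd 1 a y * comp W p 1 y) * Real.sqrt (gram g p y).det = 0 := by
  refine (isMetricOn_gram g p).integral_pd_mul_eq_zero ha (hW p) fun y hy => ?_
  have := divergence_eq g hW ((extChartAt (𝓡 2) p).map_target hy)
  rw [hdiv, (extChartAt (𝓡 2) p).right_inv hy] at this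
  exact this.symm

theorem contDiffOn_comp_covDeriv {X : ∀ x : M, TangentSpace (𝓡 2) x} {n k : ℕ∞ω}
    (hX : IsField n X) (hn : n ≤ ∞) (hkn : k + 1 ≤ n) (q : M) (i : Fin 2) :
    ContDiffOn ℝ k (comp (covDeriv g X X) q i) (extChartAt (𝓡 2) q).target := by
  have hc : ∀ q i, ContDiffOn ℝ n (comp X q i) (extChartAt (𝓡 2) q).target :=
    fun q i => contDiffOn_comp hX q i hn
  have h1 : (1 : ℕ∞ω) ≤ n := le_add_self.trans hkn
  have hk : k ≤ n := le_self_add.trans hkn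
  refine ContDiffOn.congr ?_ fun y hy => comp_covDeriv g X (fun q i => (hc q i).of_le h1) hy i
  exact ContDiffOn.sum (s := Finset.univ) fun b _ =>
    ((isMetricOn_gram g q).contDiffOn_covM (hc q) hkn (hk.trans hn) i b).mul ((hc q b).of_le hk)

variable [T2Space M] [MeasurableSpace M] [BorelSpace M]

/-- The gradient along `η` of a function supported in a chart is normal to the group of
volume-preserving diffeomorphisms. -/
theorem isNormal_gradExtend {η : M ≃ₘ^∞⟮𝓡 2, 𝓡 2⟯ M} (hη : IsVolumePreserving g η) {a : E2 → ℝ}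
    (ha : IsTest ∞ (extChartAt (𝓡 2) p).target a) :
    IsNormal g η fun x => gradExtend g p a (η x) := by
  refine ⟨(isField_gradExtend g ha).comp η.contMDiff, fun Y hY hdiv => ?_⟩
  have hc : ∀ q i, ContDiffOn ℝ 1 (comp Y q i) (extChartAt (𝓡 2) q).target :=
    fun q i => (contDiffOn_comp hY q i le_rfl).of_le (by simp)
  have h1 := hη.integral_comp η.toHomeomorph.measurableEmbedding
    fun x => (show ℝ from mfderiv (𝓡 2) 𝓘(ℝ, ℝ) (extend p a) x (Y x))
  rw [integral_mfderiv_extend g ha fun i => (hc p i).continuousOn,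
    integral_pd_mul_comp_eq_zero hc hdiv p ha] at h1
  rw [← h1]
  simp only [innerL2, inner_gradExtend g ha]

/-- It suffices to test the weak equation `div ∇_X X = 0` against functions supported in a chart. -/
theorem eq_zero_of_isWeaklyDivFree [CompactSpace M] (hK : ∀ x : M, gaussCurvature g x ≠ 0)
    {X : ∀ x : M, TangentSpace (𝓡 2) x} (hX : IsField 1 X) (hdiv : ∀ x, divergence g X x = 0)
    (hweak : ∀ (p : M) (a : E2 → ℝ), IsTest ∞ (extChartAt (𝓡 2) p).target a →
      ∫ x, (show ℝ from mfderiv (𝓡 2) 𝓘(ℝ, ℝ) (extend p a) x (covDeriv g X X x)) ∂(vol g) = 0)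
    (x : M) : X x = 0 :=
  eq_zero_of_integral_eq_zero hK hX hdiv (fun p a ha => by
    rw [← hweak p a ha, integral_mfderiv_extend g ha fun i =>
      (contDiffOn_comp_covDeriv (k := 0) hX (by simp) (by simp) p i).continuousOn]) x

/-- An asymptotic vector is orthogonal to the gradients along `η` of functions supported in a chart.
As `η` preserves the volume, `∇_X X` is therefore divergence-free in the weak sense. -/
theorem IsAsymptotic.eq_zero [CompactSpace M] (hK : ∀ x : M, gaussCurvature g x ≠ 0)
    {η : M ≃ₘ^∞⟮𝓡 2, 𝓡 2⟯ M} (hη : IsVolumePreserving g η)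
    {V : ∀ x : M, TangentSpace (𝓡 2) (η x)} (hV : IsAsymptotic g η V) (x : M) : V x = 0 := by
  obtain ⟨X, hX, hdiv, hVX, hn⟩ := hV
  rw [hVX]
  refine eq_zero_of_isWeaklyDivFree hK hX hdiv (fun p a ha => ?_) _
  have h1 := hη.integral_comp η.toHomeomorph.measurableEmbedding
    fun x => (show ℝ from mfderiv (𝓡 2) 𝓘(ℝ, ℝ) (extend p a) x (covDeriv g X X x))
  rw [← h1, ← hn _ (isNormal_gradExtend hη ha)]
  simp only [innerL2, ← inner_gradExtend g ha]
  congr 1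
  funext x
  exact g.symm _ _ _

end

end SurfaceFlow

end

theorem mainTheorem4 {M : Type*} [TopologicalSpace M] [T2Space M] [CompactSpace M]
    [ChartedSpace (EuclideanSpace ℝ (Fin 2)) M] [IsManifold (𝓡 2) ∞ M]
    [MeasurableSpace M] [BorelSpace M]
    (g : SurfaceFlow.Metric M) (hK : ∀ x : M, SurfaceFlow.gaussCurvature g x ≠ 0) :
    (∀ ψ : M → ℝ, ContMDiff (𝓡 2) 𝓘(ℝ, ℝ) 2 ψ → SurfaceFlow.SolvesMongeAmpere g ψ →
      IsLocallyConstant ψ ∧ (ConnectedSpace M → ∃ c : ℝ, ∀ x, ψ x = c)) ∧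
    (∀ X : ∀ x : M, TangentSpace (𝓡 2) x, SurfaceFlow.IsField 2 X →
      (∀ x, SurfaceFlow.divergence g X x = 0) →
      (∀ x, SurfaceFlow.divergence g (SurfaceFlow.covDeriv g X X) x = 0) →
      ∀ x, X x = 0) ∧
    (∀ X : ∀ x : M, TangentSpace (𝓡 2) x, SurfaceFlow.IsField 1 X →
      (∀ x, SurfaceFlow.divergence g X x = 0) →
      SurfaceFlow.IsWeaklyDivFree g (SurfaceFlow.covDeriv g X X) →
      ∀ x, X x = 0) ∧
    (∀ η : M ≃ₘ^∞⟮𝓡 2, 𝓡 2⟯ M, SurfaceFlow.IsVolumePreserving g η →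
      ∀ V : ∀ x : M, TangentSpace (𝓡 2) (η x), SurfaceFlow.IsAsymptotic g η V →
      ∀ x, V x = 0) := by
  refine ⟨fun ψ hψ h => ?_, fun X hX hdiv hdiv2 => ?_, fun X hX hdiv hweak => ?_,
    fun η hη V hV => hV.eq_zero hK hη⟩
  · have hl := SurfaceFlow.isLocallyConstant_of_solvesMongeAmpere hK hψ h
    exact ⟨hl, fun _ => ⟨ψ (Classical.arbitrary M), fun x =>
      hl.apply_eq_of_preconnectedSpace _ _⟩⟩
  · exact SurfaceFlow.eq_zero_of_integral_eq_zero hK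
      (hX.of_le (by norm_num : (1 : ℕ∞ω) ≤ 2)) hdiv fun p a ha =>
      SurfaceFlow.integral_pd_mul_comp_eq_zero (fun q i => SurfaceFlow.contDiffOn_comp_covDeriv hX
        (WithTop.coe_le_coe.2 le_top) (by norm_num) q i) hdiv2 p ha
  · exact SurfaceFlow.eq_zero_of_isWeaklyDivFree hK hX hdiv fun p a ha =>
      hweak _ (SurfaceFlow.contMDiff_extend ha)
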